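/- Let $n\ge 2$, $\nu>0$, $\frac n2<q\le n$ and $S\ge 0$. There are constants $N_2>0$ and $\gamma>0$, depending only on $n,\nu,q$ and $S$, such that the following holds. Let $R_0>0$, $B_R=\{x\in\mathbb R^n:|x|<R\}$, and let $a=(a_{ij})$ be a measurable $n\times n$ matrix function on $B_{R_0}$ that is uniformly elliptic: for almost every $x\in B_{R_0}$ and all $\xi,\eta\in\mathbb R^n$, $$\nu|\xi|^2\le a_{ij}(x)\xi_i\xi_j,\qquad |a_{ij}(x)\xi_j\eta_i|\le\nu^{-1}|\xi||\eta|$$ (for symmetric $a$ this is the same as $\nu|\xi|^2\le a_{ij}(x)\xi_i\xi_j\le\nu^{-1}|\xi|^2$; repeated indices are summed). Let $\mathbf b=(b_i)\in L_q(B_{R_0};\mathbb R^n)$ satisfy $\operatorname{div}\mathbf b\le 0$ in $B_{R_0}$ in the sense of distributions and $$\sup_{0<R<R_0}R^{1-\frac nq}\|\mathbf b\|_{L_q(B_R)}\le S .$$ Let $u$ be a Lipschitz solution in $B_{R_0}$ of $-D_i(a_{ij}D_ju)+b_iD_iu=0$, i.e. $u$ is Lipschitz on $B_{R_0}$ and $$\int_{B_{R_0}}\big(a_{ij}D_ju\,D_i\eta+b_iD_iu\,\eta\big)\,dx=0$$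 for every nonnegative Lipschitz function $\eta$ with compact support in $B_{R_0}$. Then $$\operatorname*{osc}_{B_\rho}u\le N_2\Big(\frac\rho r\Big)^{\gamma}\operatorname*{osc}_{B_r}u\qquad\text{for all }0<\rho<r\le R_0,$$ where $\operatorname{osc}_{B}u=\sup_{B}u-\inf_{B}u$. -/

import Mathlib

open MeasureTheory Set
open scoped ENNReal NNReal ContDiff

namespace DivEq

/-- The Euclidean space `ℝⁿ`. -/
abbrev E (n : ℕ) : Type := EuclideanSpace ℝ (Fin n)

/-- The partial derivative `D_i u (x)`. For a function that is Lipschitz on an open set it exists at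
almost every point of that set (Rademacher). -/
noncomputable def D {n : ℕ} (i : Fin n) (u : E n → ℝ) (x : E n) : ℝ :=
  fderiv ℝ u x (EuclideanSpace.single i 1)

/-- The bilinear form `a_{ij} ξ_j η_i`. -/
def form {n : ℕ} (A : Matrix (Fin n) (Fin n) ℝ) (ξ η : E n) : ℝ :=
  ∑ i, ∑ j, A i j * ξ j * η i

/-- Uniform ellipticity in `Ω` of a measurable matrix `a` with constant `ν`:
`ν |ξ|² ≤ a_{ij} ξ_i ξ_j` and `|a_{ij} ξ_j η_i| ≤ ν⁻¹ |ξ| |η|`.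
For a symmetric matrix this is the same as `ν |ξ|² ≤ a_{ij} ξ_i ξ_j ≤ ν⁻¹ |ξ|²` (Cauchy-Schwarz);
symmetry itself is not required. -/
structure UniformlyElliptic {n : ℕ} (ν : ℝ) (a : E n → Matrix (Fin n) (Fin n) ℝ)
    (Ω : Set (E n)) : Prop where
  measurable : ∀ i j, AEMeasurable (fun x => a x i j) (volume.restrict Ω)
  lower : ∀ᵐ x ∂volume.restrict Ω, ∀ ξ : E n, ν * ‖ξ‖ ^ 2 ≤ form (a x) ξ ξ
  upper : ∀ᵐ x ∂volume.restrict Ω, ∀ ξ η : E n, |form (a x) ξ η| ≤ ν⁻¹ * ‖ξ‖ * ‖η‖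

/-- `div b ≤ 0` in `Ω` in the sense of distributions: `⟨div b, η⟩ = -∫ b_i D_i η ≤ 0` for every
nonnegative test function `η` of class `C^∞` with compact support in `Ω`. -/
def DivNonpos {n : ℕ} (b : E n → E n) (Ω : Set (E n)) : Prop :=
  ∀ η : E n → ℝ, ContDiff ℝ ∞ η → HasCompactSupport η → tsupport η ⊆ Ω → (∀ x, 0 ≤ η x) →
    -∫ x in Ω, ∑ i, b x i * D i η x ≤ 0

/-- The weak form `∫_Ω (a_{ij} D_j u D_i η + b_i D_i u η) dx` of
`L u = -D_i (a_{ij} D_j u) + b_i D_i u`. -/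
noncomputable def weakForm {n : ℕ} (a : E n → Matrix (Fin n) (Fin n) ℝ) (b : E n → E n)
    (Ω : Set (E n)) (u η : E n → ℝ) : ℝ :=
  ∫ x in Ω, ((∑ i, ∑ j, a x i j * D j u x * D i η x) + ∑ i, b x i * D i u x * η x)

/-- Nonnegative Lipschitz test functions with compact support in `Ω`. -/
structure IsTest {n : ℕ} (Ω : Set (E n)) (η : E n → ℝ) : Prop where
  lipschitz : ∃ K : ℝ≥0, LipschitzWith K η
  compact : HasCompactSupport η
  supported : tsupport η ⊆ Ω
  nonneg : ∀ x, 0 ≤ η x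

/-- `u` is a Lipschitz subsolution of `L u = 0` in `Ω`. -/
structure IsLipschitzSubsolution {n : ℕ} (a : E n → Matrix (Fin n) (Fin n) ℝ) (b : E n → E n)
    (Ω : Set (E n)) (u : E n → ℝ) : Prop where
  lipschitz : ∃ K : ℝ≥0, LipschitzOnWith K u Ω
  weak : ∀ η, IsTest Ω η → weakForm a b Ω u η ≤ 0

/-- `u` is a Lipschitz supersolution of `L u = 0` in `Ω`. -/
structure IsLipschitzSupersolution {n : ℕ} (a : E n → Matrix (Fin n) (Fin n) ℝ) (b : E n → E n)
    (Ω : Set (E n)) (u : E n → ℝ) : Prop where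
  lipschitz : ∃ K : ℝ≥0, LipschitzOnWith K u Ω
  weak : ∀ η, IsTest Ω η → 0 ≤ weakForm a b Ω u η

/-- `u` is a Lipschitz solution of `L u = 0` in `Ω`: both a sub- and a supersolution. -/
def IsLipschitzSolution {n : ℕ} (a : E n → Matrix (Fin n) (Fin n) ℝ) (b : E n → E n)
    (Ω : Set (E n)) (u : E n → ℝ) : Prop :=
  IsLipschitzSubsolution a b Ω u ∧ IsLipschitzSupersolution a b Ω u

/-- The quantity `R^{1 - n/q} ‖b‖_{q, B_R}`, as an extended nonnegative number. -/
noncomputable def scaledNorm {n : ℕ} (q : ℝ) (b : E n → E n) (R : ℝ) : ℝ≥0∞ :=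
  ENNReal.ofReal (R ^ (1 - (n : ℝ) / q)) *
    eLpNorm b (ENNReal.ofReal q) (volume.restrict (Metric.ball (0 : E n) R))

/-- The oscillation `sup_Ω u - inf_Ω u`. A Lipschitz function on a ball is bounded there. -/
noncomputable def osc {n : ℕ} (Ω : Set (E n)) (u : E n → ℝ) : ℝ :=
  sSup (u '' Ω) - sInf (u '' Ω)

end DivEq

namespace DivEq
open Filter Topology Metric
open scoped Convolution

variable {n : ℕ}

/-! The proof is De Giorgi's method, with the sign of `div b` replacing any smallness of the drift.
Testing with `V ζ²`, where `V = (u - k)_+` and `ζ` is a cutoff, turns the drift term into `½ b·D(V²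
ζ²) - V² ζ b·Dζ`. The first part has nonnegative integral because `div b ≤ 0`, so only a term of
size `V² ζ |b| |Dζ|` supported in the cutoff region has to be estimated (`caccioppoli`). Since `-u`
solves the same equation with the same drift, both `u` and `-u` satisfy this energy inequality.

Rescaling `B_R` to the unit ball gives the weight `G = 1 + R |b(R x)|`, whose `L^q` norm is
controlled by `S` uniformly in `R`, because `R^(1 - n/q) ‖b‖_q` is scale invariant
(`deGiorgi_rescale`, `lintegral_weight_le`). Hölder puts `V` in `L^s` with `s = 2q'`, and `q > n/2`
places `s` strictly below the Sobolev exponent (`exists_exponents`). This room drives the iteration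
giving a local maximum principle (`exists_sup_bound`).

If `W ≤ 1` and `W ≤ 0` on half of a ball, the isoperimetric inequality forces the sets where `W` is
close to `1` to be small (`exists_level_set_small`); the maximum principle then keeps `W` below `1 -
θ` near the origin (`exists_density_bound`). One of `u`, `-u`, normalized about its midrange, always
meets the half-ball condition. Hence the oscillation contracts by a fixed factor from `B_R` to
`B_(R/4)` (`exists_osc_step`), and iteration gives the power rate. -/

/-! ### Mollification of Lipschitz functions -/

/-- A sequence of mollifying bump functions with radii tending to zero. -/
noncomputable def bump (n k : ℕ) : ContDiffBump (0 : E n) where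
  rIn := 1 / (2 * ((k : ℝ) + 1))
  rOut := 1 / ((k : ℝ) + 1)
  rIn_pos := by positivity
  rIn_lt_rOut := by
    have : (0 : ℝ) < (k : ℝ) + 1 := by positivity
    gcongr
    linarith

/-- The mollification of `f`. -/
noncomputable def mollify (k : ℕ) (f : E n → ℝ) : E n → ℝ :=
  (bump n k).normed volume ⋆[ContinuousLinearMap.lsmul ℝ ℝ, volume] f

lemma mollify_apply (k : ℕ) (f : E n → ℝ) (x : E n) :
    mollify k f x = ∫ t, (bump n k).normed volume t * f (x - t) := rfl

lemma tendsto_bump_rOut : Tendsto (fun k => (bump n k).rOut) atTop (𝓝 0) :=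
  tendsto_one_div_add_atTop_nhds_zero_nat

lemma integrable_normed_mul {k : ℕ} {f : E n → ℝ} (hf : Continuous f) (x : E n) :
    Integrable (fun t => (bump n k).normed volume t * f (x - t)) := by
  refine Continuous.integrable_of_hasCompactSupport ?_ ?_
  · exact (bump n k).continuous_normed.mul (hf.comp (continuous_const.sub continuous_id))
  · exact (bump n k).hasCompactSupport_normed.mul_right

lemma contDiff_mollify (k : ℕ) {f : E n → ℝ} (hf : Continuous f) :
    ContDiff ℝ ∞ (mollify k f) :=
  (bump n k).hasCompactSupport_normed.contDiff_convolution_left _ (bump n k).contDiff_normed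
    hf.locallyIntegrable

lemma lipschitzWith_mollify (k : ℕ) {f : E n → ℝ} {K : ℝ≥0} (hf : LipschitzWith K f) :
    LipschitzWith K (mollify k f) := by
  refine LipschitzWith.of_dist_le_mul fun x y => ?_
  rw [dist_eq_norm, mollify_apply, mollify_apply,
    ← integral_sub (integrable_normed_mul hf.continuous x) (integrable_normed_mul hf.continuous y)]
  calc _ ≤ ∫ t, (bump n k).normed volume t * (K * dist x y) := by
        refine norm_integral_le_of_norm_le ((bump n k).integrable_normed.mul_const _)
          (ae_of_all _ fun t => ?_)
        rw [← mul_sub, norm_mul, Real.norm_of_nonneg ((bump n k).nonneg_normed t)]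
        gcongr
        · exact (bump n k).nonneg_normed t
        · rw [← dist_eq_norm]
          simpa using hf.dist_le_mul (x - t) (y - t)
    _ = K * dist x y := by rw [integral_mul_const, (bump n k).integral_normed, one_mul]

lemma tendsto_mollify {f : E n → ℝ} (hf : Continuous f) (x : E n) :
    Tendsto (fun k => mollify k f x) atTop (𝓝 (f x)) :=
  ContDiffBump.convolution_tendsto_right_of_continuous tendsto_bump_rOut hf x

lemma mollify_nonneg (k : ℕ) {f : E n → ℝ} (hf : ∀ x, 0 ≤ f x) (x : E n) : 0 ≤ mollify k f x :=
  integral_nonneg fun t => mul_nonneg ((bump n k).nonneg_normed t) (hf _)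

lemma norm_fderiv_le {f : E n → ℝ} {K : ℝ≥0} (hf : LipschitzWith K f) (x : E n) :
    ‖fderiv ℝ f x‖ ≤ K := norm_fderiv_le_of_lipschitz ℝ hf

/-- The Lipschitz bound dominates the difference quotients, and by Rademacher `f` is differentiable
at `x - t` for almost every `t`; this permits differentiation under the integral. -/
lemma fderiv_mollify {f : E n → ℝ} {K : ℝ≥0} (hf : LipschitzWith K f) (k : ℕ) (x : E n) :
    fderiv ℝ (mollify k f) x =
      ((bump n k).normed volume ⋆[ContinuousLinearMap.lsmul ℝ ℝ, volume] (fderiv ℝ f)) x := by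
  set φ := (bump n k).normed volume
  have hφ : Continuous φ := (bump n k).continuous_normed
  have key := hasFDerivAt_integral_of_dominated_loc_of_lip' (𝕜 := ℝ) (μ := volume)
    (F := fun (x : E n) t => φ t * f (x - t)) (x₀ := x) (s := univ)
    (F' := fun t => φ t • fderiv ℝ f (x - t)) (bound := fun t => φ t * K) univ_mem
    (fun y _ => (integrable_normed_mul hf.continuous y).aestronglyMeasurable)
    (integrable_normed_mul hf.continuous x)
    (by
      refine hφ.aestronglyMeasurable.smul ?_
      exact ((measurable_fderiv ℝ f).comp (measurable_const.sub measurable_id)).aestronglyMeasurable)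
    (by
      refine ae_of_all _ fun t y _ => ?_
      rw [← mul_sub, norm_mul, Real.norm_of_nonneg ((bump n k).nonneg_normed t), mul_assoc]
      gcongr
      · exact (bump n k).nonneg_normed t
      · rw [← dist_eq_norm, ← dist_eq_norm]
        simpa using hf.dist_le_mul (y - t) (x - t))
    ((bump n k).integrable_normed.mul_const _)
    (by
      have h := (Measure.measurePreserving_sub_left (volume : Measure (E n)) x).quasiMeasurePreserving.ae
        (hf.ae_differentiableAt (μ := volume))
      filter_upwards [h] with t ht
      have h1 : HasFDerivAt (fun y : E n => f (y - t)) (fderiv ℝ f (x - t)) x := by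
        have := ht.hasFDerivAt.comp x ((hasFDerivAt_id x).sub_const t)
        simpa [Function.comp_def] using this
      exact h1.const_mul (φ t))
  exact key.2.fderiv

lemma locallyIntegrable_fderiv {f : E n → ℝ} {K : ℝ≥0} (hf : LipschitzWith K f) :
    LocallyIntegrable (fderiv ℝ f) := by
  refine (locallyIntegrable_const (K : ℝ)).mono (measurable_fderiv ℝ f).aestronglyMeasurable
    (ae_of_all _ fun x => ?_)
  simpa using norm_fderiv_le hf x

lemma ae_tendsto_fderiv_mollify {f : E n → ℝ} {K : ℝ≥0} (hf : LipschitzWith K f) :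
    ∀ᵐ x, Tendsto (fun k => fderiv ℝ (mollify k f) x) atTop (𝓝 (fderiv ℝ f x)) := by
  simp_rw [fderiv_mollify hf]
  refine ContDiffBump.ae_convolution_tendsto_right_of_locallyIntegrable (K := 2) tendsto_bump_rOut
    (Eventually.of_forall fun k => ?_) (locallyIntegrable_fderiv hf)
  simp only [bump]
  have : (0 : ℝ) < (k : ℝ) + 1 := by positivity
  apply le_of_eq
  field_simp

lemma mollify_eq_zero {k : ℕ} {f : E n → ℝ} {x : E n}
    (hx : ∀ y ∈ ball x (1 / ((k : ℝ) + 1)), f y = 0) : mollify k f x = 0 := by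
  rw [mollify_apply]
  refine integral_eq_zero_of_ae (ae_of_all _ fun t => ?_)
  by_cases ht : t ∈ ball (0 : E n) (bump n k).rOut
  · have : f (x - t) = 0 := hx _ (by simpa [bump, dist_eq_norm] using ht)
    simp [this]
  · rw [← (bump n k).support_normed_eq (μ := volume), Function.notMem_support] at ht
    simp [ht]

lemma tendsto_lintegral_fderiv_mollify {f : E n → ℝ} {K : ℝ≥0} (hf : LipschitzWith K f)
    {s : Set (E n)} (hs' : volume s ≠ ⊤) {t : ℝ} (ht : 0 ≤ t) :
    Tendsto (fun k => ∫⁻ x in s, ‖fderiv ℝ (mollify k f) x‖ₑ ^ t) atTop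
      (𝓝 (∫⁻ x in s, ‖fderiv ℝ f x‖ₑ ^ t)) := by
  refine tendsto_lintegral_of_dominated_convergence (fun _ => (K : ℝ≥0∞) ^ t) (fun k => ?_)
    (fun k => ae_of_all _ fun x => ?_) ?_ ?_
  · exact ((measurable_fderiv ℝ _).enorm).pow_const _
  · refine ENNReal.rpow_le_rpow ?_ ht
    rw [enorm_le_coe]
    exact norm_fderiv_le (lipschitzWith_mollify k hf) x
  · rw [lintegral_const, Measure.restrict_apply_univ]
    exact ENNReal.mul_ne_top (ENNReal.rpow_ne_top_of_nonneg ht ENNReal.coe_ne_top) hs'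
  · filter_upwards [ae_restrict_of_ae (ae_tendsto_fderiv_mollify hf)] with x hx
    exact ((ENNReal.continuous_rpow_const (y := t)).tendsto _).comp hx.enorm

/-! ### Sobolev and Poincaré inequalities for Lipschitz functions -/

/-- The Sobolev inequality for Lipschitz functions vanishing outside the unit ball. -/
lemma eLpNorm_le_eLpNorm_fderiv_of_lipschitz {t P : ℝ≥0} (ht : 1 ≤ t) (htn : t < n)
    (hP : (t : ℝ)⁻¹ - (n : ℝ)⁻¹ ≤ (P : ℝ)⁻¹) {f : E n → ℝ} {K : ℝ≥0} (hf : LipschitzWith K f)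
    (hf0 : ∀ x ∉ ball (0 : E n) 1, f x = 0) :
    eLpNorm f P volume ≤ eLpNormLESNormFDerivOfLeConst ℝ (volume : Measure (E n)) (ball 0 2) t P *
      eLpNorm (fderiv ℝ f) t volume := by
  set c := eLpNormLESNormFDerivOfLeConst ℝ (volume : Measure (E n)) (ball 0 2) t P
  have ht0 : t ≠ 0 := (zero_lt_one.trans_le ht).ne'
  -- The mollification radius is at most `1`, so one ball, and hence one Sobolev constant, serves
  -- all `k`.
  have hsupp : ∀ k, Function.support (mollify k f) ⊆ ball 0 2 := by
    intro k x hx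
    by_contra hx2
    refine hx (mollify_eq_zero fun y hy => hf0 y fun hy1 => hx2 ?_)
    have h1 : 1 / ((k : ℝ) + 1) ≤ 1 := by
      rw [div_le_one (by positivity)]
      linarith [Nat.cast_nonneg (α := ℝ) k]
    simp only [mem_ball, dist_eq_norm, sub_zero] at *
    calc ‖x‖ = ‖y - (y - x)‖ := by congr 1; abel
      _ ≤ ‖y‖ + ‖y - x‖ := norm_sub_le _ _
      _ < 2 := by linarith
  have hout : ∀ (g : E n → ℝ), Function.support g ⊆ ball 0 2 →
      ∫⁻ x, ‖fderiv ℝ g x‖ₑ ^ (t : ℝ) = ∫⁻ x in closedBall 0 2, ‖fderiv ℝ g x‖ₑ ^ (t : ℝ) := by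
    intro g hg
    refine (setLIntegral_eq_of_support_subset ?_).symm
    intro x hx
    by_contra hx2
    have : x ∉ tsupport g := fun h => hx2 (closure_minimal (hg.trans ball_subset_closedBall)
      isClosed_closedBall h)
    have h2 : fderiv ℝ g x = 0 := by
      by_contra h3
      exact this (support_fderiv_subset ℝ h3)
    refine hx ?_
    simp only [h2]
    rw [← ofReal_norm, norm_zero, ENNReal.ofReal_zero, ENNReal.zero_rpow_of_pos]
    exact_mod_cast zero_lt_one.trans_le ht
  have hsf : Function.support f ⊆ ball 0 2 := by
    intro x hx
    by_contra hx2
    exact hx (hf0 x fun h => hx2 (ball_subset_ball (by norm_num) h))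
  have h1 : ∀ k, eLpNorm (mollify k f) P volume ≤ c * eLpNorm (fderiv ℝ (mollify k f)) t volume :=
    fun k => eLpNorm_le_eLpNorm_fderiv_of_le volume
      ((contDiff_mollify k hf.continuous).of_le (by exact_mod_cast le_top)) (hsupp k) ht
      (by simpa using htn) (by simpa using hP) isBounded_ball
  have h2 : Tendsto (fun k => c * eLpNorm (fderiv ℝ (mollify k f)) t volume) atTop
      (𝓝 (c * eLpNorm (fderiv ℝ f) t volume)) := by
    refine ENNReal.Tendsto.const_mul ?_ (Or.inr ENNReal.coe_ne_top)
    simp_rw [eLpNorm_nnreal_eq_lintegral ht0, hout _ (hsupp _), hout _ hsf]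
    exact ((ENNReal.continuous_rpow_const (y := 1 / (t : ℝ))).tendsto _).comp
      (tendsto_lintegral_fderiv_mollify hf
        measure_closedBall_lt_top.ne t.coe_nonneg)
  -- Fatou on the left; on the right the gradient norms converge.
  refine (Lp.eLpNorm_lim_le_liminf_eLpNorm
    (fun k => (contDiff_mollify k hf.continuous).continuous.aestronglyMeasurable) f
    (ae_of_all _ fun x => tendsto_mollify hf.continuous x)).trans ?_
  rw [← h2.liminf_eq]
  exact liminf_le_liminf (Eventually.of_forall h1)

lemma lintegral_comp_affine {h : E n → ℝ≥0∞} (hh : Measurable h) (c : E n) {s : ℝ} (hs : 0 < s) :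
    ∫⁻ x, h (s • x + c) = ENNReal.ofReal ((s ^ n)⁻¹) * ∫⁻ x, h x := by
  have h1 := Measure.map_addHaar_smul (volume : Measure (E n)) hs.ne'
  have h2 : ∫⁻ x, h (s • x + c) = ∫⁻ x, h (x + c) ∂(Measure.map (s • ·) volume) := by
    rw [lintegral_map (by fun_prop) (by fun_prop)]
  rw [h2, h1, lintegral_smul_measure, lintegral_add_right_eq_self]
  simp [abs_of_pos hs]

lemma enorm_sub_le_lintegral_fderiv {f : E n → ℝ} (hf : ContDiff ℝ 1 f) (x y : E n) :
    ‖f x - f y‖ₑ ≤ ∫⁻ s in Ioc (0 : ℝ) 1, ‖fderiv ℝ f (s • x + (1 - s) • y)‖ₑ * ‖x - y‖ₑ := by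
  have hd : ∀ s : ℝ, HasDerivAt (fun s : ℝ => f (s • x + (1 - s) • y))
      (fderiv ℝ f (s • x + (1 - s) • y) (x - y)) s := by
    intro s
    have h1 : HasDerivAt (fun s : ℝ => s • x + (1 - s) • y) (x - y) s := by
      have := ((hasDerivAt_id s).smul_const x).add
        (((hasDerivAt_const s (1 : ℝ)).sub (hasDerivAt_id s)).smul_const y)
      convert! this using 1
      simp [sub_eq_add_neg]
    exact ((hf.differentiable one_ne_zero _).hasFDerivAt).comp_hasDerivAt s h1
  have hc : Continuous fun s : ℝ => fderiv ℝ f (s • x + (1 - s) • y) (x - y) :=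
    ((hf.continuous_fderiv one_ne_zero).comp (by fun_prop)).clm_apply continuous_const
  have h2 := intervalIntegral.integral_eq_sub_of_hasDerivAt (a := 0) (b := 1)
    (fun s _ => hd s) (hc.intervalIntegrable _ _)
  have h3 : f x - f y = ∫ s in Ioc (0 : ℝ) 1, fderiv ℝ f (s • x + (1 - s) • y) (x - y) := by
    rw [← intervalIntegral.integral_of_le zero_le_one, h2]
    simp
  rw [h3]
  refine (enorm_integral_le_lintegral_enorm _).trans (lintegral_mono fun s => ?_)
  exact ContinuousLinearMap.le_opENorm _ _

/-- For each `s` one of `s`, `1 - s` is at least `1/2`. Integrating first in the variable with that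
coefficient, the affine change of variables costs at most `2 ^ n`, and the other variable
contributes `volume B`. -/
lemma lintegral_segment_le (B : Set (E n)) {h : E n → ℝ≥0∞}
    (hh : Measurable h) :
    ∫⁻ x in B, ∫⁻ y in B, ∫⁻ s in Ioc (0 : ℝ) 1, h (s • x + (1 - s) • y) ≤
      2 ^ n * volume B * ∫⁻ x, h x := by
  have hm : Measurable fun p : E n × E n × ℝ => h (p.2.2 • p.1 + (1 - p.2.2) • p.2.1) := by
    fun_prop
  have e1 : ∫⁻ x in B, ∫⁻ y in B, ∫⁻ s in Ioc (0 : ℝ) 1, h (s • x + (1 - s) • y) =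
      ∫⁻ s in Ioc (0 : ℝ) 1, ∫⁻ x in B, ∫⁻ y in B, h (s • x + (1 - s) • y) := by
    rw [lintegral_lintegral_swap (μ := volume.restrict (Ioc (0 : ℝ) 1))]
    · refine lintegral_congr fun x => ?_
      rw [lintegral_lintegral_swap]
      exact (by fun_prop : Measurable fun p : E n × ℝ => h (p.2 • x + (1 - p.2) • p.1)).aemeasurable
    · have : Measurable fun q : (ℝ × E n) × E n => h (q.1.1 • q.1.2 + (1 - q.1.1) • q.2) := by
        fun_prop
      exact this.lintegral_prod_right'.aemeasurable
  have hscale : ∀ s : ℝ, 1 / 2 ≤ s → ∀ c : E n,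
      ∫⁻ x, h (s • x + c) ≤ 2 ^ n * ∫⁻ x, h x := by
    intro s hs c
    rw [lintegral_comp_affine hh c (by linarith)]
    gcongr
    have : (s ^ n)⁻¹ ≤ 2 ^ n := by
      rw [← inv_pow]
      gcongr
      rw [inv_le_comm₀ (by linarith) (by norm_num)]
      linarith
    refine (ENNReal.ofReal_le_ofReal this).trans ?_
    rw [ENNReal.ofReal_pow (by norm_num)]
    simp
  have hs : ∀ s ∈ Ioc (0 : ℝ) 1, ∫⁻ x in B, ∫⁻ y in B, h (s • x + (1 - s) • y) ≤
      2 ^ n * volume B * ∫⁻ x, h x := by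
    intro s hs
    rcases le_total (1 / 2) s with h1 | h1
    · rw [lintegral_lintegral_swap]
      · calc _ ≤ ∫⁻ y in B, 2 ^ n * ∫⁻ x, h x :=
              lintegral_mono fun y => (setLIntegral_le_lintegral _ _).trans (hscale s h1 _)
          _ = _ := by rw [lintegral_const, Measure.restrict_apply_univ]; ring
      · exact (by fun_prop : Measurable fun p : E n × E n =>
          h (s • p.1 + (1 - s) • p.2)).aemeasurable
    · calc _ ≤ ∫⁻ x in B, 2 ^ n * ∫⁻ x, h x := by
            refine lintegral_mono fun x => (setLIntegral_le_lintegral _ _).trans ?_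
            simp_rw [add_comm (s • x)]
            exact hscale (1 - s) (by linarith) _
        _ = _ := by rw [lintegral_const, Measure.restrict_apply_univ]; ring
  rw [e1]
  refine (setLIntegral_mono' measurableSet_Ioc hs).trans ?_
  simp

/-- The `L¹` Poincaré inequality on balls for `C¹` functions. -/
lemma poincare_contDiff {f : E n → ℝ} (hf : ContDiff ℝ 1 f) {r : ℝ} :
    ∫⁻ x in ball (0 : E n) r, ∫⁻ y in ball (0 : E n) r, ‖f x - f y‖ₑ ≤
      ENNReal.ofReal (2 * r) * (2 ^ n * volume (ball (0 : E n) r)) *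
        ∫⁻ x in ball (0 : E n) r, ‖fderiv ℝ f x‖ₑ := by
  set B := ball (0 : E n) r
  set h : E n → ℝ≥0∞ := B.indicator fun x => ‖fderiv ℝ f x‖ₑ
  have hh : Measurable h := (measurable_fderiv ℝ f).enorm.indicator measurableSet_ball
  have h1 : ∀ x ∈ B, ∀ y ∈ B, ‖f x - f y‖ₑ ≤
      ENNReal.ofReal (2 * r) * ∫⁻ s in Ioc (0 : ℝ) 1, h (s • x + (1 - s) • y) := by
    intro x hx y hy
    refine (enorm_sub_le_lintegral_fderiv hf x y).trans ?_
    rw [← lintegral_const_mul _ (by fun_prop)]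
    refine setLIntegral_mono' measurableSet_Ioc fun s hs => ?_
    have hmem : s • x + (1 - s) • y ∈ B :=
      (convex_ball (0 : E n) r) hx hy hs.1.le (by linarith [hs.2]) (by ring)
    simp only [h, indicator_of_mem hmem]
    rw [mul_comm]
    gcongr
    rw [← ofReal_norm]
    refine ENNReal.ofReal_le_ofReal ((norm_sub_le _ _).trans ?_)
    simp only [B, mem_ball, dist_zero_right] at hx hy
    linarith
  calc _ ≤ ∫⁻ x in B, ∫⁻ y in B,
        ENNReal.ofReal (2 * r) * ∫⁻ s in Ioc (0 : ℝ) 1, h (s • x + (1 - s) • y) :=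
        setLIntegral_mono' measurableSet_ball fun x hx =>
          setLIntegral_mono' measurableSet_ball fun y hy => h1 x hx y hy
    _ = ENNReal.ofReal (2 * r) *
        ∫⁻ x in B, ∫⁻ y in B, ∫⁻ s in Ioc (0 : ℝ) 1, h (s • x + (1 - s) • y) := by
        simp_rw [lintegral_const_mul' _ _ ENNReal.ofReal_ne_top]
    _ ≤ ENNReal.ofReal (2 * r) * (2 ^ n * volume B * ∫⁻ x, h x) := by
        gcongr
        exact lintegral_segment_le B hh
    _ = _ := by
        rw [lintegral_indicator measurableSet_ball]
        exact (mul_assoc _ _ _).symm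

/-- The `L¹` Poincaré inequality on balls for Lipschitz functions. -/
lemma poincare_lipschitz {f : E n → ℝ} {K : ℝ≥0} (hf : LipschitzWith K f) {r : ℝ} :
    ∫⁻ x in ball (0 : E n) r, ∫⁻ y in ball (0 : E n) r, ‖f x - f y‖ₑ ≤
      ENNReal.ofReal (2 * r) * (2 ^ n * volume (ball (0 : E n) r)) *
        ∫⁻ x in ball (0 : E n) r, ‖fderiv ℝ f x‖ₑ := by
  set c := ENNReal.ofReal (2 * r) * (2 ^ n * volume (ball (0 : E n) r))
  have hc : c ≠ ⊤ := by
    refine ENNReal.mul_ne_top ENNReal.ofReal_ne_top (ENNReal.mul_ne_top ?_ measure_ball_lt_top.ne)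
    exact ENNReal.pow_ne_top (by simp)
  have h1 := fun k => poincare_contDiff (r := r)
    ((contDiff_mollify k hf.continuous).of_le (by exact_mod_cast le_top))
  have h2 := tendsto_lintegral_fderiv_mollify hf (s := ball (0 : E n) r)
    measure_ball_lt_top.ne zero_le_one
  simp only [ENNReal.rpow_one] at h2
  replace h2 := ENNReal.Tendsto.const_mul h2 (Or.inr hc)
  have hcont : ∀ k, Continuous (mollify k f) := fun k => (contDiff_mollify k hf.continuous).continuous
  have hlim : ∀ x y, ‖f x - f y‖ₑ = liminf (fun k => ‖mollify k f x - mollify k f y‖ₑ) atTop :=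
    fun x y => (((tendsto_mollify hf.continuous x).sub
      (tendsto_mollify hf.continuous y)).enorm.liminf_eq).symm
  generalize mollify (n := n) = ψ at *
  have hm : ∀ k, Measurable fun p : E n × E n => ‖ψ k f p.1 - ψ k f p.2‖ₑ := by
    intro k
    have := hcont k
    fun_prop
  have h3 : ∀ x, ∫⁻ y in ball (0 : E n) r, ‖f x - f y‖ₑ ≤
      liminf (fun k => ∫⁻ y in ball (0 : E n) r, ‖ψ k f x - ψ k f y‖ₑ) atTop := by
    intro x
    simp_rw [hlim x]
    exact lintegral_liminf_le fun k => (hm k).comp (measurable_const.prodMk measurable_id)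
  have h4 : ∫⁻ x in ball (0 : E n) r,
        liminf (fun k => ∫⁻ y in ball (0 : E n) r, ‖ψ k f x - ψ k f y‖ₑ) atTop ≤
      liminf (fun k => ∫⁻ x in ball (0 : E n) r, ∫⁻ y in ball (0 : E n) r,
        ‖ψ k f x - ψ k f y‖ₑ) atTop :=
    lintegral_liminf_le fun k => (hm k).lintegral_prod_right'
  refine (lintegral_mono h3).trans (h4.trans ?_)
  rw [← h2.liminf_eq]
  exact liminf_le_liminf (Eventually.of_forall h1)

/-! ### The weak form and Lipschitz test functions -/

lemma sum_mul_D (f : E n → ℝ) (x v : E n) : ∑ i, v i * D i f x = fderiv ℝ f x v := by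
  have h : v = ∑ i, v i • EuclideanSpace.single i (1 : ℝ) := by
    ext j
    simp [Finset.sum_apply, Pi.single_apply]
  conv_rhs => rw [h]
  simp [D]

/-- The vector representing a functional. -/
noncomputable def dualVec (L : E n →L[ℝ] ℝ) : E n := (InnerProductSpace.toDual ℝ (E n)).symm L

lemma dualVec_add (L M : E n →L[ℝ] ℝ) : dualVec (L + M) = dualVec L + dualVec M := by
  simp [dualVec]

lemma dualVec_smul (c : ℝ) (L : E n →L[ℝ] ℝ) : dualVec (c • L) = c • dualVec L := by
  simp [dualVec]

lemma norm_dualVec (L : E n →L[ℝ] ℝ) : ‖dualVec L‖ = ‖L‖ := by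
  simp [dualVec]

lemma dualVec_apply (L : E n →L[ℝ] ℝ) (i : Fin n) :
    dualVec L i = L (EuclideanSpace.single i 1) := by
  have : inner ℝ (dualVec L) (EuclideanSpace.single i (1 : ℝ)) = L (EuclideanSpace.single i 1) :=
    InnerProductSpace.toDual_symm_apply
  rw [← this, EuclideanSpace.inner_single_right]
  simp

lemma form_add_right (A : Matrix (Fin n) (Fin n) ℝ) (ξ η θ : E n) :
    form A ξ (η + θ) = form A ξ η + form A ξ θ := by
  simp [form, mul_add, Finset.sum_add_distrib]

lemma form_smul_right (A : Matrix (Fin n) (Fin n) ℝ) (c : ℝ) (ξ η : E n) :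
    form A ξ (c • η) = c * form A ξ η := by
  simp only [form, Finset.mul_sum, PiLp.smul_apply, smul_eq_mul]
  exact Finset.sum_congr rfl fun i _ => Finset.sum_congr rfl fun j _ => by ring

lemma form_dualVec (A : Matrix (Fin n) (Fin n) ℝ) (u η : E n → ℝ) (x : E n) :
    ∑ i, ∑ j, A i j * D j u x * D i η x =
      form A (dualVec (fderiv ℝ u x)) (dualVec (fderiv ℝ η x)) := by
  simp [form, dualVec_apply, D]

lemma weakForm_eq (a : E n → Matrix (Fin n) (Fin n) ℝ) (b : E n → E n) (Ω : Set (E n))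
    (u η : E n → ℝ) : weakForm a b Ω u η = ∫ x in Ω,
      (form (a x) (dualVec (fderiv ℝ u x)) (dualVec (fderiv ℝ η x)) +
        fderiv ℝ u x (b x) * η x) := by
  simp only [weakForm, form_dualVec, ← sum_mul_D, Finset.sum_mul]

lemma exists_lipschitzWith_mul {f g : E n → ℝ} {K L : ℝ≥0} {M N : ℝ} (hf : LipschitzWith K f)
    (hg : LipschitzWith L g) (hfM : ∀ x, |f x| ≤ M) (hgN : ∀ x, |g x| ≤ N) :
    ∃ C, LipschitzWith C fun x => f x * g x := by
  have hM : 0 ≤ M := (abs_nonneg _).trans (hfM 0)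
  have hN : 0 ≤ N := (abs_nonneg _).trans (hgN 0)
  refine ⟨(M * L + N * K).toNNReal, LipschitzWith.of_dist_le_mul fun x y => ?_⟩
  rw [Real.coe_toNNReal _ (by positivity), Real.dist_eq]
  have h1 := hf.dist_le_mul x y
  have h2 := hg.dist_le_mul x y
  rw [Real.dist_eq] at h1 h2
  calc |f x * g x - f y * g y| = |f x * (g x - g y) + (f x - f y) * g y| := by congr 1; ring
    _ ≤ |f x| * |g x - g y| + |f x - f y| * |g y| := by
        rw [← abs_mul, ← abs_mul]; exact abs_add_le _ _
    _ ≤ M * (L * dist x y) + (K * dist x y) * N := by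
        gcongr
        · exact hfM x
        · exact hgN y
    _ = _ := by ring

lemma tsupport_subset_of_eq_zero {f : E n → ℝ} {r : ℝ} (hf : ∀ x ∉ ball (0 : E n) r, f x = 0) :
    tsupport f ⊆ closedBall 0 r := by
  refine closure_minimal (fun x hx => ?_) isClosed_closedBall
  by_contra h
  exact hx (hf x fun h' => h (ball_subset_closedBall h'))

/-- Mollifications of `η` are admissible smooth test functions once their radius is small compared
with `R - r`. Their gradients are bounded by `K` and converge almost everywhere, so integrability of
`b` allows passage to the limit. -/
lemma DivNonpos.integral_nonneg {b : E n → E n} {R : ℝ} (h : DivNonpos b (ball 0 R))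
    (hb : IntegrableOn b (ball 0 R)) {η : E n → ℝ} {K : ℝ≥0} (hη : LipschitzWith K η)
    (h0 : ∀ x, 0 ≤ η x) {r : ℝ} (hr : r < R) (hsupp : ∀ x ∉ ball (0 : E n) r, η x = 0) :
    0 ≤ ∫ x in ball 0 R, fderiv ℝ η x (b x) := by
  have hlim : Tendsto (fun k => ∫ x in ball 0 R, fderiv ℝ (mollify k η) x (b x)) atTop
      (𝓝 (∫ x in ball 0 R, fderiv ℝ η x (b x))) := by
    refine tendsto_integral_of_dominated_convergence (fun x => K * ‖b x‖) (fun k => ?_)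
      (hb.norm.const_mul _) (fun k => ae_of_all _ fun x => ?_) ?_
    · exact (ContinuousLinearMap.apply ℝ ℝ).flip.aestronglyMeasurable_comp₂
        (measurable_fderiv ℝ _).aestronglyMeasurable hb.aestronglyMeasurable
    · refine (ContinuousLinearMap.le_opNorm _ _).trans ?_
      gcongr
      exact norm_fderiv_le (lipschitzWith_mollify k hη) x
    · filter_upwards [ae_restrict_of_ae (ae_tendsto_fderiv_mollify hη)] with x hx
      exact ((ContinuousLinearMap.apply ℝ ℝ (b x)).continuous.tendsto _).comp hx
  have hev : ∀ᶠ k : ℕ in atTop, 1 / ((k : ℝ) + 1) < (R - r) / 2 :=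
    tendsto_one_div_add_atTop_nhds_zero_nat.eventually (gt_mem_nhds (by linarith))
  refine ge_of_tendsto hlim ?_
  filter_upwards [hev] with k hk
  have hz : ∀ x ∉ ball (0 : E n) ((r + R) / 2), mollify k η x = 0 := by
    refine fun x hx => mollify_eq_zero fun y hy => hsupp y fun hy1 => hx ?_
    rw [mem_ball] at *
    calc dist x 0 ≤ dist y x + dist y 0 := dist_triangle_left _ _ _
      _ < _ := by linarith
  have hts := tsupport_subset_of_eq_zero hz
  have h1 := h (mollify k η) (contDiff_mollify k hη.continuous)
    ((isCompact_closedBall _ _).of_isClosed_subset (isClosed_tsupport _) hts)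
    (hts.trans (closedBall_subset_ball (by linarith))) (mollify_nonneg k h0)
  simp only [sum_mul_D] at h1
  linarith

/-! ### Truncations and the Caccioppoli inequality -/

/-- The truncation `(u - k)_+`. -/
def posPart (u : E n → ℝ) (k : ℝ) (x : E n) : ℝ := max (u x - k) 0

lemma posPart_nonneg (u : E n → ℝ) (k : ℝ) (x : E n) : 0 ≤ posPart u k x := le_max_right _ _

lemma lipschitzWith_posPart {u : E n → ℝ} {K : ℝ≥0} (hu : LipschitzWith K u) (k : ℝ) :
    LipschitzWith K (posPart u k) := by
  have : LipschitzWith (K + 0) fun x => u x - k := hu.sub (LipschitzWith.const k)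
  rw [add_zero] at this
  exact this.max_const 0

lemma fderiv_posPart_of_lt {u : E n → ℝ} (hu : Continuous u) {k : ℝ} {x : E n} (hx : k < u x) :
    fderiv ℝ (posPart u k) x = fderiv ℝ u x := by
  have : posPart u k =ᶠ[𝓝 x] fun y => u y - k := by
    filter_upwards [hu.continuousAt.eventually (lt_mem_nhds hx)] with y hy
    exact max_eq_left (by linarith)
  rw [this.fderiv_eq, fderiv_sub_const]

/-- A zero of `f` is a minimum, and `fderiv` is `0` by convention where `f` is not differentiable.
Thus gradients of truncations vanish at every point of `{u ≤ k}`, with no exceptional set. -/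
lemma fderiv_eq_zero_of_nonneg {f : E n → ℝ} (hf : ∀ x, 0 ≤ f x) {x : E n} (hx : f x = 0) :
    fderiv ℝ f x = 0 :=
  IsLocalMin.fderiv_eq_zero (Eventually.of_forall fun y => by rw [hx]; exact hf y)

lemma norm_form_le {A : Matrix (Fin n) (Fin n) ℝ} {ν c d : ℝ} (hν : 0 < ν)
    (h : ∀ ξ η : E n, |form A ξ η| ≤ ν⁻¹ * ‖ξ‖ * ‖η‖) {ξ η : E n} (hξ : ‖ξ‖ ≤ c) (hη : ‖η‖ ≤ d) :
    |form A ξ η| ≤ ν⁻¹ * c * d := by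
  refine (h ξ η).trans ?_
  have := norm_nonneg ξ
  have : 0 ≤ c := this.trans hξ
  gcongr

lemma integrable_weakForm {ν R : ℝ} (hν : 0 < ν)
    {a : E n → Matrix (Fin n) (Fin n) ℝ} {b : E n → E n} (ha : UniformlyElliptic ν a (ball 0 R))
    (hb : IntegrableOn b (ball 0 R)) {u η : E n → ℝ} {K L : ℝ≥0} {M : ℝ} (hu : LipschitzWith K u)
    (hη : LipschitzWith L η) (hM : ∀ x, |η x| ≤ M) :
    IntegrableOn (fun x => form (a x) (dualVec (fderiv ℝ u x)) (dualVec (fderiv ℝ η x)) +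
      fderiv ℝ u x (b x) * η x) (ball 0 R) := by
  have hfin : IsFiniteMeasure (volume.restrict (ball (0 : E n) R)) :=
    ⟨by rw [Measure.restrict_apply_univ]; exact measure_ball_lt_top⟩
  have hD : ∀ (f : E n → ℝ) i, Measurable fun x => dualVec (fderiv ℝ f x) i := by
    intro f i
    simp_rw [dualVec_apply]
    exact measurable_fderiv_apply_const ℝ f _
  refine Integrable.add ?_ ?_
  · refine Integrable.of_bound (C := ν⁻¹ * K * L) ?_ ?_
    · simp only [form]
      refine AEMeasurable.aestronglyMeasurable ?_
      refine Finset.aemeasurable_fun_sum _ fun i _ => Finset.aemeasurable_fun_sum _ fun j _ => ?_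
      exact ((ha.measurable i j).mul (hD u j).aemeasurable).mul (hD η i).aemeasurable
    · filter_upwards [ha.upper] with x hx
      refine norm_form_le hν hx ?_ ?_
      · rw [norm_dualVec]; exact norm_fderiv_le hu x
      · rw [norm_dualVec]; exact norm_fderiv_le hη x
  · refine Integrable.mono' (hb.norm.const_mul (K * M)) ?_ (ae_of_all _ fun x => ?_)
    · exact ((ContinuousLinearMap.apply ℝ ℝ).flip.aestronglyMeasurable_comp₂
        (measurable_fderiv ℝ _).aestronglyMeasurable hb.aestronglyMeasurable).mul
        hη.continuous.aestronglyMeasurable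
    · rw [norm_mul]
      calc _ ≤ (K * ‖b x‖) * M := by
            gcongr
            · exact (ContinuousLinearMap.le_opNorm _ _).trans
                (by gcongr; exact norm_fderiv_le hu x)
            · exact hM x
        _ = _ := by ring

/-- The pointwise inequality behind the Caccioppoli estimate. -/
lemma caccioppoli_pointwise {ν : ℝ} (hν : 0 < ν) {A : Matrix (Fin n) (Fin n) ℝ}
    (hl : ∀ ξ : E n, ν * ‖ξ‖ ^ 2 ≤ form A ξ ξ)
    (hu : ∀ ξ η : E n, |form A ξ η| ≤ ν⁻¹ * ‖ξ‖ * ‖η‖) (β : E n) {p v z : E n →L[ℝ] ℝ} {V ζ : ℝ}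
    (hV : 0 ≤ V) (hζ : 0 ≤ ζ) (hpv : (V = 0 ∧ v = 0) ∨ p = v) :
    ν / 2 * (‖v‖ ^ 2 * ζ ^ 2) + 1 / 2 * (((2 * V * ζ ^ 2) • v + (2 * V ^ 2 * ζ) • z) β) -
      (2 * ν⁻¹ ^ 3 * (V ^ 2 * ‖z‖ ^ 2) + V ^ 2 * ζ * ‖β‖ * ‖z‖) ≤
      form A (dualVec p) (dualVec (ζ ^ 2 • v + (2 * V * ζ) • z)) + p β * (V * ζ ^ 2) := by
  rcases hpv with ⟨rfl, rfl⟩ | rfl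
  · have : dualVec (0 : E n →L[ℝ] ℝ) = 0 := by simp [dualVec]
    simp [this, form]
  · rw [dualVec_add, dualVec_smul, dualVec_smul, form_add_right, form_smul_right, form_smul_right]
    have h1 := hl (dualVec p)
    have h2 := (abs_le.1 (hu (dualVec p) (dualVec z))).1
    have h3 : |z β| ≤ ‖z‖ * ‖β‖ := z.le_opNorm β
    rw [norm_dualVec] at h1
    rw [norm_dualVec, norm_dualVec] at h2
    simp only [add_apply, smul_apply, smul_eq_mul]
    have h4 : ζ ^ 2 * (ν * ‖p‖ ^ 2) ≤ ζ ^ 2 * form A (dualVec p) (dualVec p) := by gcongr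
    have h5 : 2 * V * ζ * (-(ν⁻¹ * ‖p‖ * ‖z‖)) ≤ 2 * V * ζ * form A (dualVec p) (dualVec z) := by
      gcongr
    have h6 : V ^ 2 * ζ * z β ≤ V ^ 2 * ζ * (‖z‖ * ‖β‖) := by
      gcongr
      exact (abs_le.1 h3).2
    -- Young's inequality as a completed square: half of the ellipticity absorbs the cross term,
    -- leaving the coefficient `2 ν⁻³`.
    have h7 : 0 ≤ ν / 2 * (ζ * ‖p‖ - 2 * ν⁻¹ ^ 2 * (V * ‖z‖)) ^ 2 := by positivity
    have h8 : ν / 2 * (ζ * ‖p‖ - 2 * ν⁻¹ ^ 2 * (V * ‖z‖)) ^ 2 = ν / 2 * (‖p‖ ^ 2 * ζ ^ 2)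
        - 2 * V * ζ * (ν⁻¹ * ‖p‖ * ‖z‖) + 2 * ν⁻¹ ^ 3 * (V ^ 2 * ‖z‖ ^ 2) := by
      field_simp
      ring
    linarith

/-- With the test function `η = V ζ²`, the drift is half of `b·D(V² ζ²)` minus `V² ζ b·Dζ`. The
first part integrates to something nonnegative and is dropped, so no derivative of `V` meets `b` in
the result. The bound on `u` serves only to make the products Lipschitz and the integrals finite;
`M` does not enter the estimate. -/
lemma caccioppoli {ν R : ℝ} (hν : 0 < ν) {a : E n → Matrix (Fin n) (Fin n) ℝ} {b : E n → E n}
    (ha : UniformlyElliptic ν a (ball 0 R)) (hb : IntegrableOn b (ball 0 R))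
    (hdiv : DivNonpos b (ball 0 R)) {u : E n → ℝ} {K : ℝ≥0} {M : ℝ} (hu : LipschitzWith K u)
    (hM : ∀ x, |u x| ≤ M) (hsub : ∀ η, IsTest (ball 0 R) η → weakForm a b (ball 0 R) u η ≤ 0)
    (k : ℝ) {ζ : E n → ℝ} {L : ℝ≥0} (hζ : LipschitzWith L ζ) (hζ0 : ∀ x, 0 ≤ ζ x)
    (hζ1 : ∀ x, ζ x ≤ 1) {r : ℝ} (hr : r < R) (hsupp : ∀ x ∉ ball (0 : E n) r, ζ x = 0) :
    ENNReal.ofReal (ν / 2) *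
        ∫⁻ x in ball 0 R, ENNReal.ofReal (‖fderiv ℝ (posPart u k) x‖ ^ 2 * ζ x ^ 2) ≤
      ∫⁻ x in ball 0 R, ENNReal.ofReal (2 * ν⁻¹ ^ 3 * (posPart u k x ^ 2 * ‖fderiv ℝ ζ x‖ ^ 2) +
        posPart u k x ^ 2 * ζ x * ‖b x‖ * ‖fderiv ℝ ζ x‖) := by
  set V := posPart u k
  have hfin : IsFiniteMeasure (volume.restrict (ball (0 : E n) R)) :=
    ⟨by rw [Measure.restrict_apply_univ]; exact measure_ball_lt_top⟩
  have hV : LipschitzWith K V := lipschitzWith_posPart hu k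
  have hV0 : ∀ x, 0 ≤ V x := posPart_nonneg u k
  have hVN : ∀ x, |V x| ≤ M + |k| := fun x => by
    rw [abs_of_nonneg (hV0 x)]
    have := (abs_le.1 (hM x)).2
    have := (abs_le.1 (hM x)).1
    refine max_le ?_ ?_ <;> linarith [neg_abs_le k, abs_nonneg k]
  set N := M + |k|
  have hN : 0 ≤ N := (abs_nonneg _).trans (hVN 0)
  have hζa : ∀ x, |ζ x| ≤ 1 := fun x => by rw [abs_of_nonneg (hζ0 x)]; exact hζ1 x
  obtain ⟨C1, hC1⟩ := exists_lipschitzWith_mul hV hζ hVN hζa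
  have hVζ : ∀ x, |V x * ζ x| ≤ N := fun x => by
    rw [abs_mul]
    exact (mul_le_mul (hVN x) (hζa x) (abs_nonneg _) hN).trans (mul_one N).le
  obtain ⟨C2, hC2⟩ := exists_lipschitzWith_mul hC1 hζ hVζ hζa
  obtain ⟨C3, hC3⟩ := exists_lipschitzWith_mul hC1 hC1 hVζ hVζ
  set η : E n → ℝ := fun x => V x * ζ x * ζ x
  -- The test function for `div b ≤ 0`: half of `b·Dφ` is the part of the drift with a sign.
  set φ : E n → ℝ := fun x => V x * ζ x * (V x * ζ x)
  have hηM : ∀ x, |η x| ≤ N := fun x => by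
    rw [abs_mul]
    exact (mul_le_mul (hVζ x) (hζa x) (abs_nonneg _) hN).trans (mul_one N).le
  have hη0 : ∀ x ∉ ball (0 : E n) r, η x = 0 := fun x hx => by simp [η, hsupp x hx]
  have hφ0 : ∀ x ∉ ball (0 : E n) r, φ x = 0 := fun x hx => by simp [φ, hsupp x hx]
  have htest : IsTest (ball 0 R) η :=
    { lipschitz := ⟨C2, hC2⟩
      compact := (isCompact_closedBall _ _).of_isClosed_subset (isClosed_tsupport _)
        (tsupport_subset_of_eq_zero hη0)
      supported := (tsupport_subset_of_eq_zero hη0).trans (closedBall_subset_ball hr)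
      nonneg := fun x => mul_nonneg (mul_nonneg (hV0 x) (hζ0 x)) (hζ0 x) }
  have hweak := hsub η htest
  rw [weakForm_eq] at hweak
  have hdivφ := hdiv.integral_nonneg hb hC3 (fun x => mul_self_nonneg _) hr hφ0
  have hFint := integrable_weakForm hν ha hb hu hC2 hηM
  have hmV := (measurable_fderiv ℝ V).norm
  have hmζ := (measurable_fderiv ℝ ζ).norm
  have hcV := hV.continuous.measurable
  have hcζ := hζ.continuous.measurable
  have hI1 : IntegrableOn (fun x => ‖fderiv ℝ V x‖ ^ 2 * ζ x ^ 2) (ball 0 R) := by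
    refine Integrable.of_bound (C := (K : ℝ) ^ 2 * 1 ^ 2)
      (by fun_prop) (ae_of_all _ fun x => ?_)
    rw [norm_mul, norm_pow, norm_pow, norm_norm]
    gcongr
    · exact norm_fderiv_le hV x
    · exact hζa x
  have hI2 : IntegrableOn (fun x => fderiv ℝ φ x (b x)) (ball 0 R) := by
    refine Integrable.mono' (hb.norm.const_mul C3) ?_ (ae_of_all _ fun x => ?_)
    · exact (ContinuousLinearMap.apply ℝ ℝ).flip.aestronglyMeasurable_comp₂
        (measurable_fderiv ℝ _).aestronglyMeasurable hb.aestronglyMeasurable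
    · exact (ContinuousLinearMap.le_opNorm _ _).trans (by gcongr; exact norm_fderiv_le hC3 x)
  have hI3 : IntegrableOn (fun x => 2 * ν⁻¹ ^ 3 * (V x ^ 2 * ‖fderiv ℝ ζ x‖ ^ 2) +
        V x ^ 2 * ζ x * ‖b x‖ * ‖fderiv ℝ ζ x‖) (ball 0 R) := by
    refine Integrable.add (Integrable.const_mul ?_ _) ?_
    · refine Integrable.of_bound (C := N ^ 2 * (L : ℝ) ^ 2)
        (by fun_prop) (ae_of_all _ fun x => ?_)
      rw [norm_mul, norm_pow, norm_pow, norm_norm]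
      gcongr
      · exact hVN x
      · exact norm_fderiv_le hζ x
    · refine Integrable.mono' (hb.norm.const_mul (N ^ 2 * 1 * L)) ?_ (ae_of_all _ fun x => ?_)
      · have := hb.aestronglyMeasurable.norm
        have h2 : Measurable fun x => V x ^ 2 * ζ x := by fun_prop
        exact (h2.aestronglyMeasurable.mul this).mul hmζ.aestronglyMeasurable
      · rw [norm_mul, norm_mul, norm_mul, norm_pow, norm_norm, norm_norm]
        calc _ ≤ N ^ 2 * 1 * ‖b x‖ * L := by
              gcongr
              · exact hVN x
              · exact hζa x
              · exact norm_fderiv_le hζ x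
          _ = _ := by ring
  have hpt : ∀ᵐ x ∂volume.restrict (ball (0 : E n) R),
      ν / 2 * (‖fderiv ℝ V x‖ ^ 2 * ζ x ^ 2) + 1 / 2 * fderiv ℝ φ x (b x) -
      (2 * ν⁻¹ ^ 3 * (V x ^ 2 * ‖fderiv ℝ ζ x‖ ^ 2) + V x ^ 2 * ζ x * ‖b x‖ * ‖fderiv ℝ ζ x‖) ≤
      form (a x) (dualVec (fderiv ℝ u x)) (dualVec (fderiv ℝ η x)) + fderiv ℝ u x (b x) * η x := by
    filter_upwards [ha.upper, ha.lower, ae_restrict_of_ae hV.ae_differentiableAt,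
      ae_restrict_of_ae hζ.ae_differentiableAt] with x hux hlx hVx hζx
    have e1 : fderiv ℝ η x = ζ x ^ 2 • fderiv ℝ V x + (2 * V x * ζ x) • fderiv ℝ ζ x := by
      have := ((hVx.hasFDerivAt.mul hζx.hasFDerivAt).mul hζx.hasFDerivAt).fderiv
      refine this.trans ?_
      ext y
      simp
      ring
    have e2 : fderiv ℝ φ x =
        (2 * V x * ζ x ^ 2) • fderiv ℝ V x + (2 * V x ^ 2 * ζ x) • fderiv ℝ ζ x := by
      have h := hVx.hasFDerivAt.mul hζx.hasFDerivAt
      refine (h.mul h).fderiv.trans ?_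
      ext y
      simp
      ring
    rw [e1, e2, show η x = V x * ζ x ^ 2 by simp only [η]; ring]
    refine caccioppoli_pointwise hν hlx hux (b x) (hV0 x) (hζ0 x) ?_
    rcases lt_or_ge k (u x) with h | h
    · exact Or.inr (fderiv_posPart_of_lt hu.continuous h).symm
    · have h0 : V x = 0 := max_eq_right (by linarith)
      exact Or.inl ⟨h0, fderiv_eq_zero_of_nonneg hV0 h0⟩
  have hI12 : IntegrableOn (fun x => ν / 2 * (‖fderiv ℝ V x‖ ^ 2 * ζ x ^ 2) +
      1 / 2 * fderiv ℝ φ x (b x)) (ball 0 R) := (hI1.const_mul _).add (hI2.const_mul _)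
  have hfinal := (integral_mono_ae (hI12.sub hI3) hFint hpt).trans hweak
  simp only [Pi.sub_apply] at hfinal
  rw [integral_sub hI12 hI3, integral_add (hI1.const_mul _) (hI2.const_mul _), integral_const_mul,
    integral_const_mul] at hfinal
  rw [← ofReal_integral_eq_lintegral_ofReal hI1 (ae_of_all _ fun x => by positivity),
    ← ofReal_integral_eq_lintegral_ofReal hI3 (ae_of_all _ fun x => by
      have := hζ0 x
      positivity), ← ENNReal.ofReal_mul (by positivity)]
  exact ENNReal.ofReal_le_ofReal (by linarith)

lemma exists_cutoff (n : ℕ) {ρ r : ℝ} (h : ρ < r) :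
    ∃ ζ : E n → ℝ, LipschitzWith (r - ρ)⁻¹.toNNReal ζ ∧ (∀ x, 0 ≤ ζ x) ∧ (∀ x, ζ x ≤ 1) ∧
      (∀ x ∈ ball (0 : E n) ρ, ζ x = 1) ∧ ∀ x ∉ ball (0 : E n) r, ζ x = 0 := by
  have hd : 0 < r - ρ := by linarith
  have hl : LipschitzWith (r - ρ)⁻¹.toNNReal fun x : E n => (r - ‖x‖) * (r - ρ)⁻¹ := by
    refine LipschitzWith.of_dist_le_mul fun x y => ?_
    rw [Real.coe_toNNReal _ (by positivity), Real.dist_eq, ← sub_mul, abs_mul,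
      abs_of_pos (inv_pos.2 hd), mul_comm]
    gcongr
    rw [sub_sub_sub_cancel_left, dist_comm, dist_eq_norm]
    exact abs_norm_sub_norm_le _ _
  refine ⟨fun x => max (min ((r - ‖x‖) * (r - ρ)⁻¹) 1) 0, (hl.min_const 1).max_const 0,
    fun x => le_max_right _ _, fun x => max_le (min_le_right _ _) zero_le_one, fun x hx => ?_,
    fun x hx => ?_⟩
  · rw [mem_ball, dist_zero_right] at hx
    have : 1 ≤ (r - ‖x‖) * (r - ρ)⁻¹ := by
      rw [← div_eq_mul_inv, one_le_div hd]
      linarith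
    simp [min_eq_right this]
  · rw [mem_ball, dist_zero_right, not_lt] at hx
    refine max_eq_right ((min_le_left _ _).trans ?_)
    exact mul_nonpos_of_nonpos_of_nonneg (by linarith) (by positivity)

/-- The cutoff has slope `(r - ρ)⁻¹`. The drift carries only one power of this slope, so its scaling
matches that of `R |b(R x)|`. -/
lemma caccioppoli_ball {ν R : ℝ} (hν : 0 < ν) {a : E n → Matrix (Fin n) (Fin n) ℝ} {b : E n → E n}
    (ha : UniformlyElliptic ν a (ball 0 R)) (hb : IntegrableOn b (ball 0 R))
    (hdiv : DivNonpos b (ball 0 R)) {u : E n → ℝ} {K : ℝ≥0} {M : ℝ} (hu : LipschitzWith K u)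
    (hM : ∀ x, |u x| ≤ M) (hsub : ∀ η, IsTest (ball 0 R) η → weakForm a b (ball 0 R) u η ≤ 0)
    (k : ℝ) {ρ r : ℝ} (hρ : ρ < r) (hr : r < R) :
    ∫⁻ x in ball 0 ρ, ‖fderiv ℝ (posPart u k) x‖ₑ ^ 2 ≤
      ENNReal.ofReal (2 / ν * (2 * ν⁻¹ ^ 3 + 1)) * ∫⁻ x in ball 0 r,
        ENNReal.ofReal (posPart u k x ^ 2 * ((r - ρ)⁻¹ ^ 2 + (r - ρ)⁻¹ * ‖b x‖)) := by
  obtain ⟨ζ, hζ, hζ0, hζ1, hζρ, hζr⟩ := exists_cutoff n hρ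
  have hd : 0 < r - ρ := by linarith
  have h := caccioppoli hν ha hb hdiv hu hM hsub k hζ hζ0 hζ1 hr hζr
  have h1 : ∫⁻ x in ball 0 ρ, ‖fderiv ℝ (posPart u k) x‖ₑ ^ 2 ≤
      ∫⁻ x in ball 0 R, ENNReal.ofReal (‖fderiv ℝ (posPart u k) x‖ ^ 2 * ζ x ^ 2) := by
    refine le_trans ?_ (lintegral_mono_set (ball_subset_ball (hρ.trans hr).le))
    refine setLIntegral_mono' measurableSet_ball fun x hx => ?_
    rw [hζρ x hx, one_pow, mul_one, ENNReal.ofReal_pow (norm_nonneg _), ofReal_norm]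
  have h2 : ∫⁻ x in ball 0 R, ENNReal.ofReal
        (2 * ν⁻¹ ^ 3 * (posPart u k x ^ 2 * ‖fderiv ℝ ζ x‖ ^ 2) +
        posPart u k x ^ 2 * ζ x * ‖b x‖ * ‖fderiv ℝ ζ x‖) ≤
      ENNReal.ofReal (2 * ν⁻¹ ^ 3 + 1) * ∫⁻ x in ball 0 r,
        ENNReal.ofReal (posPart u k x ^ 2 * ((r - ρ)⁻¹ ^ 2 + (r - ρ)⁻¹ * ‖b x‖)) := by
    rw [← lintegral_const_mul' _ _ ENNReal.ofReal_ne_top, ← lintegral_indicator measurableSet_ball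
      (fun x => _ * _)]
    refine (setLIntegral_le_lintegral _ _).trans (lintegral_mono fun x => ?_)
    by_cases hx : x ∈ ball (0 : E n) r
    · rw [indicator_of_mem hx, ← ENNReal.ofReal_mul (by positivity)]
      refine ENNReal.ofReal_le_ofReal ?_
      have hz : ‖fderiv ℝ ζ x‖ ≤ (r - ρ)⁻¹ := by
        simpa [Real.coe_toNNReal _ (inv_pos.2 hd).le] using norm_fderiv_le hζ x
      have e1 : posPart u k x ^ 2 * ‖fderiv ℝ ζ x‖ ^ 2 ≤ posPart u k x ^ 2 * (r - ρ)⁻¹ ^ 2 := by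
        gcongr
      have e2 : posPart u k x ^ 2 * ζ x * ‖b x‖ * ‖fderiv ℝ ζ x‖ ≤
          posPart u k x ^ 2 * 1 * ‖b x‖ * (r - ρ)⁻¹ := by
        gcongr
        exact hζ1 x
      have e3 : 0 ≤ posPart u k x ^ 2 * (r - ρ)⁻¹ ^ 2 := by positivity
      have e4 : 0 ≤ posPart u k x ^ 2 * 1 * ‖b x‖ * (r - ρ)⁻¹ := by positivity
      have e5 : 0 ≤ 2 * ν⁻¹ ^ 3 := by positivity
      nlinarith [mul_le_mul_of_nonneg_left e1 e5, mul_nonneg e5 e4]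
    · have : fderiv ℝ ζ x = 0 := fderiv_eq_zero_of_nonneg hζ0 (hζr x hx)
      simp [this, indicator_of_notMem hx]
  have h3 : ENNReal.ofReal (2 / ν) * ENNReal.ofReal (ν / 2) = 1 := by
    rw [← ENNReal.ofReal_mul (by positivity)]
    field_simp
    simp
  calc _ ≤ ENNReal.ofReal (2 / ν) * (ENNReal.ofReal (ν / 2) *
        ∫⁻ x in ball 0 R, ENNReal.ofReal (‖fderiv ℝ (posPart u k) x‖ ^ 2 * ζ x ^ 2)) := by
        rw [← mul_assoc, h3, one_mul]; exact h1
    _ ≤ ENNReal.ofReal (2 / ν) * (ENNReal.ofReal (2 * ν⁻¹ ^ 3 + 1) * ∫⁻ x in ball 0 r,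
        ENNReal.ofReal (posPart u k x ^ 2 * ((r - ρ)⁻¹ ^ 2 + (r - ρ)⁻¹ * ‖b x‖))) := by
        exact mul_le_mul_right (h.trans h2) _
    _ = _ := by rw [← mul_assoc, ← ENNReal.ofReal_mul (by positivity)]

/-! ### The De Giorgi class and rescaling to the unit ball -/

/-- The De Giorgi class in the unit ball with weight `G`. -/
structure DeGiorgi (C : ℝ) (G : E n → ℝ≥0∞) (W : E n → ℝ) : Prop where
  lipschitz : ∃ K : ℝ≥0, LipschitzWith K W
  energy : ∀ k ρ r, 0 < ρ → ρ < r → r ≤ 1 →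
    ∫⁻ x in ball 0 ρ, ‖fderiv ℝ (posPart W k) x‖ₑ ^ 2 ≤ ENNReal.ofReal (C / (r - ρ) ^ 2) *
      ∫⁻ x in ball 0 r, G x * ENNReal.ofReal (posPart W k x) ^ 2

/-- Truncating `c (W - d)` at `k` gives `c` times the truncation of `W` at `k / c + d`, and both
sides of the energy inequality are quadratic in the truncation. -/
lemma DeGiorgi.affine {C : ℝ} {G : E n → ℝ≥0∞} {W : E n → ℝ} (h : DeGiorgi C G W) {c : ℝ}
    (hc : 0 < c) (d : ℝ) : DeGiorgi C G fun x => c * (W x - d) := by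
  obtain ⟨K, hK⟩ := h.lipschitz
  refine ⟨⟨c.toNNReal * K, ?_⟩, fun k ρ r hρ hρr hr => ?_⟩
  · refine LipschitzWith.of_dist_le_mul fun x y => ?_
    rw [NNReal.coe_mul, Real.coe_toNNReal _ hc.le, Real.dist_eq, ← mul_sub, abs_mul,
      abs_of_pos hc, mul_assoc, sub_sub_sub_cancel_right, ← Real.dist_eq]
    gcongr
    exact hK.dist_le_mul x y
  · have h1 := h.energy (k / c + d) ρ r hρ hρr hr
    have e : posPart (fun x => c * (W x - d)) k = fun x => c * posPart W (k / c + d) x := by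
      ext x
      simp only [posPart]
      rw [mul_max_of_nonneg _ _ hc.le, mul_zero]
      congr 1
      field_simp
      ring
    have e2 : ∀ x, fderiv ℝ (posPart (fun x => c * (W x - d)) k) x =
        c • fderiv ℝ (posPart W (k / c + d)) x := by
      intro x
      rw [e]
      exact congrFun (fderiv_const_smul_field (𝕜 := ℝ) (f := posPart W (k / c + d)) c) x
    simp_rw [e2, e, enorm_smul, mul_pow, ENNReal.ofReal_mul hc.le, mul_pow, mul_left_comm (G _)]
    have ht : ENNReal.ofReal c ^ 2 ≠ ⊤ := ENNReal.pow_ne_top ENNReal.ofReal_ne_top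
    rw [Real.enorm_of_nonneg hc.le, lintegral_const_mul' _ _ ht, lintegral_const_mul' _ _ ht,
      mul_left_comm]
    gcongr

lemma map_smul_restrict_ball {R : ℝ} (hR : 0 < R) (ρ : ℝ) :
    Measure.map (R • ·) (volume.restrict (ball (0 : E n) ρ)) =
      ENNReal.ofReal ((R ^ n)⁻¹) • volume.restrict (ball (0 : E n) (R * ρ)) := by
  have h1 := Measure.map_addHaar_smul (volume : Measure (E n)) hR.ne'
  have h2 := MeasurableEquiv.restrict_map (Homeomorph.smulOfNeZero R hR.ne').toMeasurableEquiv
    (μ := (volume : Measure (E n))) (ball 0 (R * ρ))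
  have h3 : (Homeomorph.smulOfNeZero R hR.ne').toMeasurableEquiv ⁻¹' (ball (0 : E n) (R * ρ)) =
      ball 0 ρ := by
    ext x
    simp [norm_smul, abs_of_pos hR, hR]
  rw [h3] at h2
  have h4 : ⇑(Homeomorph.smulOfNeZero R hR.ne').toMeasurableEquiv = fun x : E n => R • x := rfl
  rw [h4, h1, Measure.restrict_smul] at h2
  rw [← h2]
  simp [abs_of_pos hR]

lemma setLIntegral_ball_comp_smul {R : ℝ} (hR : 0 < R) (ρ : ℝ) (h : E n → ℝ≥0∞) :
    ∫⁻ x in ball 0 ρ, h (R • x) =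
      ENNReal.ofReal ((R ^ n)⁻¹) * ∫⁻ x in ball 0 (R * ρ), h x := by
  rw [← smul_eq_mul, ← lintegral_smul_measure, ← map_smul_restrict_ball hR]
  exact (lintegral_map_equiv h (Homeomorph.smulOfNeZero R hR.ne').toMeasurableEquiv).symm

lemma aemeasurable_comp_smul {β : Type*} [MeasurableSpace β] {R : ℝ} (hR : 0 < R) (ρ : ℝ)
    {h : E n → β} (hh : AEMeasurable h (volume.restrict (ball 0 (R * ρ)))) :
    AEMeasurable (fun x => h (R • x)) (volume.restrict (ball 0 ρ)) := by
  have : AEMeasurable h (Measure.map (R • ·) (volume.restrict (ball (0 : E n) ρ))) := by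
    rw [map_smul_restrict_ball hR]
    exact hh.smul_measure _
  exact this.comp_measurable (measurable_const_smul R)

/-- A rescaled subsolution belongs to the De Giorgi class. -/
lemma deGiorgi_rescale {ν R₀ R : ℝ} (hν : 0 < ν) {a : E n → Matrix (Fin n) (Fin n) ℝ}
    {b : E n → E n} (ha : UniformlyElliptic ν a (ball 0 R₀)) (hb : IntegrableOn b (ball 0 R₀))
    (hdiv : DivNonpos b (ball 0 R₀)) {u : E n → ℝ} {K : ℝ≥0} {M : ℝ} (hu : LipschitzWith K u)
    (hM : ∀ x, |u x| ≤ M) (hsub : ∀ η, IsTest (ball 0 R₀) η → weakForm a b (ball 0 R₀) u η ≤ 0)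
    (hR : 0 < R) (hRR : R < R₀) :
    DeGiorgi (2 / ν * (2 * ν⁻¹ ^ 3 + 1)) (fun x => 1 + ENNReal.ofReal R * ‖b (R • x)‖ₑ)
      fun x => u (R • x) := by
  set C := 2 / ν * (2 * ν⁻¹ ^ 3 + 1)
  refine ⟨⟨K * R.toNNReal, ?_⟩, fun k ρ r hρ hρr hr => ?_⟩
  · refine LipschitzWith.of_dist_le_mul fun x y => (hu.dist_le_mul _ _).trans ?_
    rw [dist_smul₀, NNReal.coe_mul, Real.coe_toNNReal _ hR.le, Real.norm_of_nonneg hR.le, mul_assoc]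
  have h := caccioppoli_ball hν ha hb hdiv hu hM hsub k (mul_lt_mul_of_pos_left hρr hR)
    ((mul_le_of_le_one_right hR.le hr).trans_lt hRR)
  have hd : 0 < r - ρ := by linarith
  have e : ∀ x, fderiv ℝ (posPart (fun x => u (R • x)) k) x =
      R • fderiv ℝ (posPart u k) (R • x) := by
    intro x
    exact fderiv_comp_smul (f := posPart u k) R
  simp_rw [e, enorm_smul, mul_pow, Real.enorm_of_nonneg hR.le]
  have ht : ENNReal.ofReal R ^ 2 ≠ ⊤ := ENNReal.pow_ne_top ENNReal.ofReal_ne_top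
  rw [lintegral_const_mul' _ _ ht,
    setLIntegral_ball_comp_smul hR ρ fun x => ‖fderiv ℝ (posPart u k) x‖ₑ ^ 2]
  calc _ ≤ ENNReal.ofReal R ^ 2 * (ENNReal.ofReal ((R ^ n)⁻¹) * (ENNReal.ofReal C *
        ∫⁻ x in ball 0 (R * r), ENNReal.ofReal (posPart u k x ^ 2 *
          ((R * r - R * ρ)⁻¹ ^ 2 + (R * r - R * ρ)⁻¹ * ‖b x‖)))) := by gcongr
    _ = ENNReal.ofReal C * ∫⁻ x in ball 0 r, ENNReal.ofReal R ^ 2 * ENNReal.ofReal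
          (posPart u k (R • x) ^ 2 *
          ((R * r - R * ρ)⁻¹ ^ 2 + (R * r - R * ρ)⁻¹ * ‖b (R • x)‖)) := by
        rw [lintegral_const_mul' _ _ ht, setLIntegral_ball_comp_smul hR r fun x => ENNReal.ofReal
          (posPart u k x ^ 2 * ((R * r - R * ρ)⁻¹ ^ 2 + (R * r - R * ρ)⁻¹ * ‖b x‖))]
        ring
    _ ≤ ENNReal.ofReal C * ∫⁻ x in ball 0 r, ENNReal.ofReal ((r - ρ)⁻¹ ^ 2) *
        ((1 + ENNReal.ofReal R * ‖b (R • x)‖ₑ) * ENNReal.ofReal (posPart u k (R • x)) ^ 2) := by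
        refine mul_le_mul_right (lintegral_mono fun x => ?_) _
        rw [← ofReal_norm, ← ENNReal.ofReal_mul hR.le, ← ENNReal.ofReal_one,
          ← ENNReal.ofReal_add zero_le_one (by positivity), ← ENNReal.ofReal_pow hR.le,
          ← ENNReal.ofReal_pow (posPart_nonneg _ _ _), ← ENNReal.ofReal_mul (by positivity),
          ← ENNReal.ofReal_mul (by positivity), ← ENNReal.ofReal_mul (by positivity)]
        refine ENNReal.ofReal_le_ofReal ?_
        have h1 : R ^ 2 * ((R * r - R * ρ)⁻¹ ^ 2 + (R * r - R * ρ)⁻¹ * ‖b (R • x)‖) =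
            (r - ρ)⁻¹ ^ 2 + (r - ρ)⁻¹ * (R * ‖b (R • x)‖) := by
          rw [← mul_sub]
          field_simp
        -- Since `r - ρ ≤ 1`, both terms fit under the single prefactor `(r - ρ)⁻²`.
        have h2 : (r - ρ)⁻¹ ≤ (r - ρ)⁻¹ ^ 2 := by
          refine le_self_pow₀ ?_ two_ne_zero
          rw [one_le_inv₀ hd]
          linarith
        calc _ = posPart u k (R • x) ^ 2 * (R ^ 2 * ((R * r - R * ρ)⁻¹ ^ 2 +
              (R * r - R * ρ)⁻¹ * ‖b (R • x)‖)) := by ring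
          _ = posPart u k (R • x) ^ 2 *
              ((r - ρ)⁻¹ ^ 2 + (r - ρ)⁻¹ * (R * ‖b (R • x)‖)) := by rw [h1]
          _ ≤ posPart u k (R • x) ^ 2 *
              ((r - ρ)⁻¹ ^ 2 + (r - ρ)⁻¹ ^ 2 * (R * ‖b (R • x)‖)) := by gcongr
          _ = _ := by ring
    _ = _ := by
        rw [lintegral_const_mul' _ _ ENNReal.ofReal_ne_top, ← mul_assoc,
          ← ENNReal.ofReal_mul (by positivity)]
        congr 2
        field_simp

/-- Minkowski, together with the identity between the `L^q(B_1)` norm of `R b(R ·)` and `R^(1 - n/q)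
‖b‖_(L^q(B_R))`. The bound does not depend on `R`, so the constants of the unit-ball theory are the
same at every scale. -/
lemma lintegral_weight_le {R₀ R q : ℝ} (hq : 1 ≤ q) {b : E n → E n} {S : ℝ≥0}
    (hb : AEStronglyMeasurable b (volume.restrict (ball 0 R₀))) (hR : 0 < R) (hRR : R < R₀)
    (hS : scaledNorm q b R ≤ S) :
    (∫⁻ x in ball 0 1, (1 + ENNReal.ofReal R * ‖b (R • x)‖ₑ) ^ q) ^ (1 / q) ≤
      volume (ball (0 : E n) 1) ^ (1 / q) + S := by
  have hq0 : 0 < q := by linarith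
  have hm : AEMeasurable (fun x => ‖b (R • x)‖ₑ) (volume.restrict (ball 0 1)) := by
    refine aemeasurable_comp_smul hR 1 (h := fun x => ‖b x‖ₑ) ?_
    rw [mul_one]
    exact (hb.mono_measure (Measure.restrict_mono (ball_subset_ball hRR.le) le_rfl)).enorm
  refine (ENNReal.lintegral_Lp_add_le (f := fun _ => 1) aemeasurable_const
    (hm.const_mul _) hq).trans ?_
  gcongr
  · simp
  · refine le_trans (le_of_eq ?_) hS
    simp_rw [ENNReal.mul_rpow_of_nonneg _ _ hq0.le]
    rw [lintegral_const_mul' _ _ (by finiteness),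
      setLIntegral_ball_comp_smul hR 1 fun x => ‖b x‖ₑ ^ q, mul_one, scaledNorm,
      eLpNorm_eq_lintegral_rpow_enorm_toReal (by simpa using hq0) ENNReal.ofReal_ne_top,
      ENNReal.toReal_ofReal hq0.le, ← mul_assoc, ENNReal.mul_rpow_of_nonneg _ _ (by positivity)]
    congr 1
    rw [ENNReal.ofReal_rpow_of_pos hR, ← ENNReal.ofReal_mul (by positivity),
      ENNReal.ofReal_rpow_of_pos (by positivity)]
    congr 1
    rw [Real.mul_rpow (by positivity) (by positivity), ← Real.rpow_mul hR.le, mul_one_div_cancel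
      hq0.ne', Real.rpow_one, ← Real.rpow_natCast, ← Real.rpow_neg hR.le, ← Real.rpow_mul hR.le,
      sub_eq_add_neg, Real.rpow_add hR, Real.rpow_one]
    congr 2
    ring

/-! ### Local maximum principle by De Giorgi iteration -/

/-- The room is `δ = 1/n - 1/(2q) > 0`. With `1/t = 1/2 + δ/2` and `1/P = 1/t - 1/n`, one has `1/s -
1/P = δ/2`. Half of `δ` pays for `t < 2`, which keeps `t < n` even when `n = 2`; the other half is
the gain `s < P`. -/
lemma exists_exponents (hn : 2 ≤ n) {q : ℝ} (hq : (n : ℝ) / 2 < q) :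
    ∃ q' : ℝ, q.HolderConjugate q' ∧ ∃ s t P : ℝ≥0, (s : ℝ) = 2 * q' ∧ 1 ≤ t ∧ t < 2 ∧ t < n ∧
      (t : ℝ)⁻¹ - (n : ℝ)⁻¹ ≤ (P : ℝ)⁻¹ ∧ s < P := by
  have hn' : (2 : ℝ) ≤ n := by exact_mod_cast hn
  have hq1 : 1 < q := by linarith
  have hc := Real.HolderConjugate.conjExponent hq1
  refine ⟨_, hc, ?_⟩
  set q' := Real.conjExponent q
  have hq' := hc.symm.lt
  have hinv : q'⁻¹ = 1 - q⁻¹ := hc.one_sub_inv.symm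
  have hδ0 : 0 < (n : ℝ)⁻¹ - q⁻¹ / 2 := by
    have : q⁻¹ < (n / 2 : ℝ)⁻¹ := by
      gcongr
    rw [inv_div] at this
    have h2 : (2 : ℝ) / n = 2 * (n : ℝ)⁻¹ := rfl
    linarith
  set δ := (n : ℝ)⁻¹ - q⁻¹ / 2 with hδ
  have hn2 : (n : ℝ)⁻¹ ≤ 1 / 2 := by rw [one_div]; gcongr
  have hq0 : 0 < q⁻¹ := by positivity
  have ht : 0 < 1 / 2 + δ / 2 := by linarith
  have hP : 0 < 1 / 2 + δ / 2 - (n : ℝ)⁻¹ := by linarith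
  have ht2 : (1 / 2 + δ / 2)⁻¹ < 2 := by
    rw [inv_lt_comm₀ ht (by norm_num)]
    linarith
  obtain ⟨s, hs⟩ : ∃ s : ℝ≥0, (s : ℝ) = 2 * q' := ⟨_, Real.coe_toNNReal _ (by positivity)⟩
  obtain ⟨t, htt⟩ : ∃ t : ℝ≥0, (t : ℝ) = (1 / 2 + δ / 2)⁻¹ :=
    ⟨_, Real.coe_toNNReal _ (by positivity)⟩
  obtain ⟨P, hPP⟩ : ∃ P : ℝ≥0, (P : ℝ) = (1 / 2 + δ / 2 - (n : ℝ)⁻¹)⁻¹ :=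
    ⟨_, Real.coe_toNNReal _ (by positivity)⟩
  refine ⟨s, t, P, hs, ?_, ?_, ?_, ?_, ?_⟩
  · rw [← NNReal.coe_le_coe, htt, NNReal.coe_one, one_le_inv₀ ht]
    linarith
  · rw [← NNReal.coe_lt_coe, htt]
    exact ht2
  · rw [← NNReal.coe_lt_coe, htt]
    exact ht2.trans_le (by simpa using hn')
  · rw [htt, hPP, inv_inv, inv_inv]
  · rw [← NNReal.coe_lt_coe, hs, hPP, lt_inv_comm₀ (by positivity) hP, mul_inv, hinv]
    linarith

/-- Fast geometric convergence. -/
lemma exists_tendsto_zero_of_recursion {M : ℝ≥0∞} (hM : M ≠ ⊤) {θ : ℝ} (hθ : 0 < θ) :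
    ∃ ε : ℝ≥0∞, 0 < ε ∧ ∀ y : ℕ → ℝ≥0∞, (∀ j, y (j + 1) ≤ M * 4 ^ j * y j * y j ^ θ) →
      y 0 ≤ ε → Tendsto y atTop (𝓝 0) := by
  -- The ratio satisfies `l ^ θ = 1/4`, which cancels the growth `4 ^ j` in the induction `y j ≤ ε l
  -- ^ j`.
  set l : ℝ≥0∞ := (4⁻¹ : ℝ≥0∞) ^ (1 / θ)
  have h4 : (4⁻¹ : ℝ≥0∞) < 1 := ENNReal.inv_lt_one.2 (by norm_num)
  have hl1 : l < 1 := ENNReal.rpow_lt_one h4 (by positivity)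
  have hl0 : 0 < l := ENNReal.rpow_pos (by simp) h4.ne_top
  have hlθ : l ^ θ = 4⁻¹ := by
    rw [← ENNReal.rpow_mul, one_div_mul_cancel hθ.ne', ENNReal.rpow_one]
  have hM1 : M + 1 ≠ ⊤ := by simpa using hM
  -- Chosen so that `M ε ^ θ ≤ l`; `M + 1` avoids dividing by zero.
  set ε : ℝ≥0∞ := (l / (M + 1)) ^ (1 / θ)
  have hε0 : 0 < ε := by
    refine ENNReal.rpow_pos (ENNReal.div_pos hl0.ne' hM1) (ENNReal.div_lt_top hl1.ne_top ?_).ne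
    simp
  have hεt : ε ≠ ⊤ := by
    refine ENNReal.rpow_ne_top_of_nonneg (by positivity) (ENNReal.div_lt_top hl1.ne_top ?_).ne
    simp
  have hεθ : M * ε ^ θ ≤ l := by
    rw [← ENNReal.rpow_mul, one_div_mul_cancel hθ.ne', ENNReal.rpow_one]
    calc M * (l / (M + 1)) ≤ (M + 1) * (l / (M + 1)) := by gcongr; exact le_self_add
      _ ≤ l := ENNReal.mul_div_le
  refine ⟨ε, hε0, fun y hy h0 => ?_⟩
  have key : ∀ j, y j ≤ ε * l ^ j := by
    intro j
    induction j with
    | zero => simpa using h0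
    | succ j ih =>
      calc y (j + 1) ≤ M * 4 ^ j * (ε * l ^ j) * (ε * l ^ j) ^ θ := by
            refine (hy j).trans ?_
            gcongr
        _ = (M * ε ^ θ) * (ε * l ^ j) * (4 ^ j * (l ^ θ) ^ j) := by
            have hlj : (l ^ j) ^ θ = (l ^ θ) ^ j := by
              rw [← ENNReal.rpow_natCast l, ← ENNReal.rpow_mul, mul_comm, ENNReal.rpow_mul,
                ENNReal.rpow_natCast]
            rw [ENNReal.mul_rpow_of_nonneg _ _ hθ.le, hlj]
            ring
        _ ≤ l * (ε * l ^ j) * 1 := by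
            gcongr
            rw [hlθ, ← mul_pow, ENNReal.mul_inv_cancel (by simp) (by simp), one_pow]
        _ = _ := by ring
  refine tendsto_of_tendsto_of_tendsto_of_le_of_le tendsto_const_nhds ?_ (fun _ => zero_le) key
  have := ENNReal.Tendsto.const_mul (a := ε) (ENNReal.tendsto_pow_atTop_nhds_zero_of_lt_one hl1)
    (Or.inr hεt)
  simpa using this

lemma eLpNorm_two_pow {F : Type*} [NormedAddCommGroup F] (f : E n → F) (μ : Measure (E n)) :
    eLpNorm f 2 μ = (∫⁻ x, ‖f x‖ₑ ^ 2 ∂μ) ^ (1 / 2 : ℝ) := by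
  rw [eLpNorm_eq_lintegral_rpow_enorm_toReal (by simp) (by simp)]
  simp

lemma enorm_posPart (W : E n → ℝ) (k : ℝ) (x : E n) :
    ‖posPart W k x‖ₑ = ENNReal.ofReal (posPart W k x) :=
  Real.enorm_of_nonneg (posPart_nonneg W k x)

/-- The hypotheses on the weight. -/
structure IsWeight (q : ℝ) (Λ : ℝ≥0∞) (G : E n → ℝ≥0∞) : Prop where
  aemeasurable : AEMeasurable G (volume.restrict (ball 0 1))
  one_le : ∀ x, 1 ≤ G x
  lintegral_le : (∫⁻ x in ball 0 1, G x ^ q) ^ (1 / q) ≤ Λ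

/-- Hölder with exponents `q` and `q'`; this fixes `s = 2q'` as the exponent of the iteration. -/
lemma IsWeight.lintegral_mul_le {q q' : ℝ} (hc : q.HolderConjugate q') {Λ : ℝ≥0∞}
    {G : E n → ℝ≥0∞} (hG : IsWeight q Λ G) {s : ℝ≥0} (hs : (s : ℝ) = 2 * q') {V : E n → ℝ}
    (hV : Measurable V) {r : ℝ} (hr : r ≤ 1) :
    ∫⁻ x in ball 0 r, G x * ‖V x‖ₑ ^ 2 ≤ Λ * eLpNorm V s (volume.restrict (ball 0 r)) ^ 2 := by
  have hle : volume.restrict (ball (0 : E n) r) ≤ volume.restrict (ball 0 1) :=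
    Measure.restrict_mono (ball_subset_ball hr) le_rfl
  have hq' := hc.symm.pos
  refine (ENNReal.lintegral_mul_le_Lp_mul_Lq _ hc (hG.aemeasurable.mono_measure hle)
    (by fun_prop : Measurable fun x => ‖V x‖ₑ ^ 2).aemeasurable).trans ?_
  refine mul_le_mul' (le_trans ?_ hG.lintegral_le) (le_of_eq ?_)
  · exact ENNReal.rpow_le_rpow (lintegral_mono' hle le_rfl) (by have := hc.pos; positivity)
  · have hs0 : s ≠ 0 := by
      rintro rfl
      simp only [NNReal.coe_zero] at hs
      linarith
    rw [eLpNorm_nnreal_eq_lintegral hs0, ← ENNReal.rpow_natCast, ← ENNReal.rpow_mul, hs]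
    congr 1
    · refine lintegral_congr fun x => ?_
      rw [← ENNReal.rpow_natCast, ← ENNReal.rpow_mul]
      norm_num
    · field_simp
      norm_num

/-- The Sobolev inequality with a cutoff. -/
lemma eLpNorm_ball_le_of_lipschitz {t P : ℝ≥0} (ht1 : 1 ≤ t) (ht2 : t < 2) (htn : t < n)
    (hP : (t : ℝ)⁻¹ - (n : ℝ)⁻¹ ≤ (P : ℝ)⁻¹) {V : E n → ℝ} {K : ℝ≥0} (hV : LipschitzWith K V)
    (hV0 : ∀ x, 0 ≤ V x) {ρ m : ℝ} (hρm : ρ < m) (hm : m ≤ 1) :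
    eLpNorm V P (volume.restrict (ball 0 ρ)) ≤
      eLpNormLESNormFDerivOfLeConst ℝ (volume : Measure (E n)) (ball 0 2) t P *
        ((eLpNorm (fderiv ℝ V) 2 (volume.restrict (ball 0 m)) +
          ENNReal.ofReal (m - ρ)⁻¹ * eLpNorm V 2 (volume.restrict (ball 0 m))) *
        volume (ball (0 : E n) 1) ^ (1 / (t : ℝ) - 1 / 2)) := by
  have ht : 0 ≤ 1 / (t : ℝ) - 1 / 2 := by
    have h1 : (1 : ℝ) ≤ t := by exact_mod_cast ht1
    have h2 : (t : ℝ) < 2 := by exact_mod_cast ht2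
    rw [sub_nonneg]
    gcongr
  have hVm : Measurable V := hV.continuous.measurable
  obtain ⟨ζ, hζ, hζ0, hζ1, hζρ, hζm⟩ := exists_cutoff n hρm
  -- `V` may be unbounded globally. Capping it at its maximum over the unit ball leaves `V ζ`
  -- unchanged and makes the product visibly Lipschitz.
  obtain ⟨N, hN⟩ : ∃ N, ∀ x ∈ closedBall (0 : E n) 1, V x ≤ N :=
    (isCompact_closedBall (0 : E n) 1).exists_isMaxOn ⟨0, by simp⟩ hV.continuous.continuousOn
      |>.elim fun y hy => ⟨V y, fun x hx => hy.2 hx⟩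
  have hN0 : 0 ≤ N := (hV0 0).trans (hN 0 (by simp))
  have hV' : LipschitzWith K fun x => min (V x) N := hV.min_const N
  obtain ⟨L, hL⟩ := exists_lipschitzWith_mul hV' hζ (M := N) (N := 1)
    (fun x => by rw [abs_of_nonneg (le_min (hV0 x) hN0)]; exact min_le_right _ _)
    (fun x => by rw [abs_of_nonneg (hζ0 x)]; exact hζ1 x)
  have hf_eq : (fun x => min (V x) N * ζ x) = fun x => V x * ζ x := by
    ext x
    by_cases hx : x ∈ ball (0 : E n) m
    · rw [min_eq_left (hN x (ball_subset_closedBall (ball_subset_ball hm hx)))]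
    · simp [hζm x hx]
  rw [hf_eq] at hL
  obtain ⟨f, hf⟩ : ∃ f : E n → ℝ, f = fun x => V x * ζ x := ⟨_, rfl⟩
  rw [← hf] at hL
  have hfx : ∀ x, f x = V x * ζ x := fun x => by rw [hf]
  have hf0 : ∀ x, 0 ≤ f x := fun x => by rw [hfx]; exact mul_nonneg (hV0 x) (hζ0 x)
  have hfm : ∀ x ∉ ball (0 : E n) m, f x = 0 := fun x hx => by rw [hfx, hζm x hx, mul_zero]
  have hsob := eLpNorm_le_eLpNorm_fderiv_of_lipschitz ht1 htn hP hL
    (fun x hx => hfm x fun h => hx (ball_subset_ball hm h))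
  have h1 : eLpNorm V P (volume.restrict (ball 0 ρ)) ≤ eLpNorm f P volume := by
    refine le_trans (le_of_eq (eLpNorm_congr_ae ?_))
      (eLpNorm_mono_measure f (Measure.restrict_le_self (s := ball 0 ρ)))
    filter_upwards [ae_restrict_mem measurableSet_ball] with x hx
    rw [hfx, hζρ x hx, mul_one]
  have h2 : eLpNorm (fderiv ℝ f) t (volume.restrict (ball 0 m)) =
      eLpNorm (fderiv ℝ f) t volume := by
    have hsupp : Function.support (fun x => ‖fderiv ℝ f x‖) ⊆ ball 0 m := by
      intro x hx
      by_contra h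
      refine hx ?_
      simp only [fderiv_eq_zero_of_nonneg hf0 (hfm x h), norm_zero]
    rw [← eLpNorm_norm, ← eLpNorm_norm (fderiv ℝ f)]
    exact eLpNorm_restrict_eq_of_support_subset hsupp
  have h3 : eLpNorm (fderiv ℝ f) t (volume.restrict (ball 0 m)) ≤
      eLpNorm (fderiv ℝ f) 2 (volume.restrict (ball 0 m)) *
      volume (ball (0 : E n) 1) ^ (1 / (t : ℝ) - 1 / 2) := by
    refine (eLpNorm_le_eLpNorm_mul_rpow_measure_univ (q := 2) (by exact_mod_cast ht2.le)
      (measurable_fderiv ℝ f).aestronglyMeasurable).trans ?_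
    simp only [ENNReal.coe_toReal, ENNReal.toReal_ofNat, Measure.restrict_apply_univ]
    exact mul_le_mul_right (ENNReal.rpow_le_rpow (measure_mono (ball_subset_ball hm)) ht) _
  have e1 : eLpNorm (fderiv ℝ f) 2 (volume.restrict (ball 0 m)) ≤
      eLpNorm ((fun x => ‖fderiv ℝ V x‖) + fun x => (m - ρ)⁻¹ • V x) 2
        (volume.restrict (ball 0 m)) := by
    refine eLpNorm_mono_ae_real ?_
    filter_upwards [ae_restrict_of_ae hV.ae_differentiableAt,
      ae_restrict_of_ae hζ.ae_differentiableAt] with x hVx hζx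
    have : fderiv ℝ f x = V x • fderiv ℝ ζ x + ζ x • fderiv ℝ V x := by
      rw [hf]
      exact (hVx.hasFDerivAt.mul hζx.hasFDerivAt).fderiv
    have hz : ‖fderiv ℝ ζ x‖ ≤ (m - ρ)⁻¹ := by
      simpa [Real.coe_toNNReal _ (inv_pos.2 (sub_pos.2 hρm)).le] using norm_fderiv_le hζ x
    rw [this, Pi.add_apply, smul_eq_mul]
    refine (norm_add_le _ _).trans ?_
    rw [norm_smul, norm_smul, Real.norm_of_nonneg (hV0 x), Real.norm_of_nonneg (hζ0 x), add_comm,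
      mul_comm (V x)]
    exact add_le_add (mul_le_of_le_one_left (norm_nonneg _) (hζ1 x))
      (mul_le_mul_of_nonneg_right hz (hV0 x))
  have e2 := eLpNorm_add_le (p := 2) (μ := volume.restrict (ball (0 : E n) m))
    (measurable_fderiv ℝ V).norm.aestronglyMeasurable
    (hVm.const_smul (m - ρ)⁻¹).aestronglyMeasurable (by norm_num)
  have e3 : eLpNorm (fun x => (m - ρ)⁻¹ • V x) 2 (volume.restrict (ball 0 m)) ≤
      ENNReal.ofReal (m - ρ)⁻¹ * eLpNorm V 2 (volume.restrict (ball 0 m)) := by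
    refine (eLpNorm_const_smul_le (c := (m - ρ)⁻¹) (f := V)).trans (le_of_eq ?_)
    rw [Real.enorm_of_nonneg (inv_pos.2 (sub_pos.2 hρm)).le]
  rw [eLpNorm_norm] at e2
  refine h1.trans (hsob.trans (mul_le_mul_right ?_ _))
  rw [← h2]
  exact h3.trans (mul_le_mul_left (e1.trans (e2.trans (add_le_add le_rfl e3))) _)

/-- The gain of integrability for truncations in the De Giorgi class. -/
lemma exists_gain {q q' : ℝ} (hc : q.HolderConjugate q') {s t P : ℝ≥0} (hs : (s : ℝ) = 2 * q')
    (ht1 : 1 ≤ t) (ht2 : t < 2) (htn : t < n) (hP : (t : ℝ)⁻¹ - (n : ℝ)⁻¹ ≤ (P : ℝ)⁻¹)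
    {C : ℝ} (hC : 0 ≤ C) {Λ : ℝ≥0∞} (hΛ : Λ ≠ ⊤) :
    ∃ A : ℝ≥0∞, A ≠ ⊤ ∧ ∀ (G : E n → ℝ≥0∞) (W : E n → ℝ), IsWeight q Λ G → DeGiorgi C G W →
      ∀ k ρ r, 0 < ρ → ρ < r → r ≤ 1 → eLpNorm (posPart W k) P (volume.restrict (ball 0 ρ)) ≤
        A * ENNReal.ofReal (r - ρ)⁻¹ * eLpNorm (posPart W k) s (volume.restrict (ball 0 r)) := by
  have hsob := fun (V : E n → ℝ) (K : ℝ≥0) (hV : LipschitzWith K V) hV0 ρ m hρm hm =>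
    eLpNorm_ball_le_of_lipschitz ht1 ht2 htn hP hV hV0 (ρ := ρ) (m := m) hρm hm
  generalize eLpNormLESNormFDerivOfLeConst ℝ (volume : Measure (E n)) (ball 0 2) t P = cS at hsob
  have ht : 0 ≤ 1 / (t : ℝ) - 1 / 2 := by
    have h1 : (1 : ℝ) ≤ t := by exact_mod_cast ht1
    have h2 : (t : ℝ) < 2 := by exact_mod_cast ht2
    rw [sub_nonneg]
    gcongr
  have hvol : volume (ball (0 : E n) 1) ^ (1 / (t : ℝ) - 1 / 2) ≠ ⊤ :=
    ENNReal.rpow_ne_top_of_nonneg ht measure_ball_lt_top.ne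
  generalize volume (ball (0 : E n) 1) ^ (1 / (t : ℝ) - 1 / 2) = vol at hvol hsob
  have hΛ' : Λ ^ (1 / 2 : ℝ) ≠ ⊤ := ENNReal.rpow_ne_top_of_nonneg (by norm_num) hΛ
  refine ⟨cS * (ENNReal.ofReal (2 * (√C + 1)) * Λ ^ (1 / 2 : ℝ) * vol), by finiteness,
    fun G W hG hW k ρ r hρ hρr hr => ?_⟩
  obtain ⟨K, hK⟩ := hW.lipschitz
  have hV : LipschitzWith K (posPart W k) := lipschitzWith_posPart hK k
  -- The gap is shared: Sobolev with a cutoff from `m` to `ρ`, the energy inequality from `r` to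
  -- `m`.
  obtain ⟨m, hm⟩ : ∃ m, m = (ρ + r) / 2 := ⟨_, rfl⟩
  have hρm : ρ < m := by linarith
  have hmr : m < r := by linarith
  have henergy := hW.energy k m r (by linarith) hmr hr
  simp_rw [← enorm_posPart] at henergy
  have h0 := hsob _ K hV (posPart_nonneg W k) ρ m hρm (by linarith)
  generalize posPart W k = V at *
  have hVm : Measurable V := hV.continuous.measurable
  obtain ⟨J, hJ⟩ : ∃ J, J = ∫⁻ x in ball 0 r, G x * ‖V x‖ₑ ^ 2 := ⟨_, rfl⟩
  rw [← hJ] at henergy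
  have hd : (m - ρ)⁻¹ = 2 * (r - ρ)⁻¹ := by
    rw [hm, show (ρ + r) / 2 - ρ = (r - ρ) / 2 by ring, inv_div]
    rfl
  have hd' : r - m = (r - ρ) / 2 := by rw [hm]; ring
  have hrρ : 0 < r - ρ := by linarith
  -- The cutoff term is absorbed in the weighted integral because `1 ≤ G`.
  have hVJ : ∫⁻ x in ball 0 m, ‖V x‖ₑ ^ 2 ≤ J := by
    rw [hJ]
    refine (lintegral_mono_set (ball_subset_ball hmr.le)).trans (lintegral_mono fun x => ?_)
    exact le_mul_of_one_le_left' (hG.one_le x)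
  have e2 : eLpNorm (fderiv ℝ V) 2 (volume.restrict (ball 0 m)) ≤
      ENNReal.ofReal (√C * (2 * (r - ρ)⁻¹)) * J ^ (1 / 2 : ℝ) := by
    rw [eLpNorm_two_pow]
    refine (ENNReal.rpow_le_rpow henergy (by norm_num)).trans (le_of_eq ?_)
    rw [ENNReal.mul_rpow_of_nonneg _ _ (by norm_num),
      ENNReal.ofReal_rpow_of_nonneg (by positivity) (by norm_num), ← Real.sqrt_eq_rpow,
      Real.sqrt_div hC, Real.sqrt_sq (by linarith), hd']
    congr 2
    field_simp
  have e3 : ENNReal.ofReal (m - ρ)⁻¹ * eLpNorm V 2 (volume.restrict (ball 0 m)) ≤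
      ENNReal.ofReal (2 * (r - ρ)⁻¹) * J ^ (1 / 2 : ℝ) := by
    rw [eLpNorm_two_pow, hd]
    exact mul_le_mul_right (ENNReal.rpow_le_rpow hVJ (by norm_num)) _
  have h5 : J ^ (1 / 2 : ℝ) ≤ Λ ^ (1 / 2 : ℝ) * eLpNorm V s (volume.restrict (ball 0 r)) := by
    rw [hJ]
    refine (ENNReal.rpow_le_rpow (hG.lintegral_mul_le hc hs hVm hr) (by norm_num)).trans
      (le_of_eq ?_)
    rw [ENNReal.mul_rpow_of_nonneg _ _ (by norm_num), ← ENNReal.rpow_natCast, ← ENNReal.rpow_mul]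
    norm_num
  have h6 : ENNReal.ofReal (√C * (2 * (r - ρ)⁻¹)) * J ^ (1 / 2 : ℝ) +
      ENNReal.ofReal (2 * (r - ρ)⁻¹) * J ^ (1 / 2 : ℝ) =
      ENNReal.ofReal (2 * (√C + 1)) * ENNReal.ofReal (r - ρ)⁻¹ * J ^ (1 / 2 : ℝ) := by
    rw [← add_mul, ← ENNReal.ofReal_add (by positivity) (by positivity),
      ← ENNReal.ofReal_mul (by positivity)]
    congr 2
    ring
  refine h0.trans ?_
  calc _ ≤ cS * ((ENNReal.ofReal (2 * (√C + 1)) * ENNReal.ofReal (r - ρ)⁻¹ *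
        (Λ ^ (1 / 2 : ℝ) * eLpNorm V s (volume.restrict (ball 0 r)))) * vol) := by
        refine mul_le_mul_right (mul_le_mul_left ((add_le_add e2 e3).trans ?_) _) _
        rw [h6]
        exact mul_le_mul_right h5 _
    _ = _ := by ring

lemma posPart_mono (W : E n → ℝ) {k k' : ℝ} (h : k ≤ k') (x : E n) :
    posPart W k' x ≤ posPart W k x :=
  max_le_max (by linarith) le_rfl

/-- One step of the De Giorgi iteration. -/
lemma eLpNorm_posPart_step {s P : ℝ≥0} (hs : 0 < s) (hsP : s < P) {A : ℝ≥0∞} {W : E n → ℝ}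
    (hW : Continuous W) {k k' ρ r : ℝ} (hk : k < k') (hρr : ρ < r)
    (hgain : eLpNorm (posPart W k') P (volume.restrict (ball 0 ρ)) ≤
        A * ENNReal.ofReal (r - ρ)⁻¹ * eLpNorm (posPart W k') s (volume.restrict (ball 0 r))) :
    eLpNorm (posPart W k') s (volume.restrict (ball 0 ρ)) ≤
      A * ENNReal.ofReal (r - ρ)⁻¹ * ENNReal.ofReal (k' - k)⁻¹ ^ (1 - (s : ℝ) / P) *
        eLpNorm (posPart W k) s (volume.restrict (ball 0 r)) *
        eLpNorm (posPart W k) s (volume.restrict (ball 0 r)) ^ (1 - (s : ℝ) / P) := by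
  have hs' : (0 : ℝ) < s := by exact_mod_cast hs
  have hP' : (0 : ℝ) < P := by exact_mod_cast hs.trans hsP
  have hsP' : (s : ℝ) < P := by exact_mod_cast hsP
  have hcont : ∀ k, Continuous (posPart W k) := fun k => (hW.sub continuous_const).max
    continuous_const
  have hd : 0 < k' - k := by linarith
  have hθ : 0 ≤ 1 / (s : ℝ) - 1 / P := by
    rw [sub_nonneg]
    gcongr
  -- `T` contains the support of the higher truncation. Hölder on `T` lowers `P` to `s`, and
  -- Chebyshev for the lower truncation bounds the measure of `T`; this produces the superlinear
  -- power.
  obtain ⟨T, hT⟩ : ∃ T, T = {x | ENNReal.ofReal (k' - k) ≤ ‖posPart W k x‖ₑ} := ⟨_, rfl⟩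
  have hsupp : Function.support (posPart W k') ⊆ T := by
    intro x hx
    have h1 : k' < W x := by
      by_contra h
      exact hx (max_eq_right (by linarith))
    rw [hT, mem_ofPred_eq, enorm_posPart]
    exact ENNReal.ofReal_le_ofReal (le_max_of_le_left (by linarith))
  have h1 : eLpNorm (posPart W k') s (volume.restrict (ball 0 ρ)) ≤
      eLpNorm (posPart W k') P (volume.restrict (ball 0 ρ)) *
        volume.restrict (ball 0 ρ) T ^ (1 / (s : ℝ) - 1 / P) := by
    rw [← eLpNorm_restrict_eq_of_support_subset hsupp]
    refine (eLpNorm_le_eLpNorm_mul_rpow_measure_univ (q := P) (by exact_mod_cast hsP.le)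
      (hcont k').aestronglyMeasurable).trans ?_
    rw [Measure.restrict_apply_univ]
    exact mul_le_mul_left (eLpNorm_mono_measure _ Measure.restrict_le_self) _
  have h2 : volume.restrict (ball 0 ρ) T ≤ (ENNReal.ofReal (k' - k)⁻¹ *
      eLpNorm (posPart W k) s (volume.restrict (ball 0 r))) ^ (s : ℝ) := by
    refine (Measure.restrict_mono (ball_subset_ball hρr.le) le_rfl T).trans ?_
    rw [hT, ENNReal.mul_rpow_of_nonneg _ _ hs'.le, ENNReal.ofReal_inv_of_pos hd]
    exact meas_ge_le_mul_pow_eLpNorm_enorm (volume.restrict (ball 0 r)) (p := s)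
      (by exact_mod_cast hs.ne') (by simp) (hcont k).aestronglyMeasurable
      (by simpa using hk) (by simp)
  have h3 : volume.restrict (ball 0 ρ) T ^ (1 / (s : ℝ) - 1 / P) ≤
      ENNReal.ofReal (k' - k)⁻¹ ^ (1 - (s : ℝ) / P) *
        eLpNorm (posPart W k) s (volume.restrict (ball 0 r)) ^ (1 - (s : ℝ) / P) := by
    refine (ENNReal.rpow_le_rpow h2 hθ).trans (le_of_eq ?_)
    have h4 : (s : ℝ) * (1 / (s : ℝ) - 1 / P) = 1 - (s : ℝ) / P := by field_simp
    rw [← ENNReal.rpow_mul, h4, ENNReal.mul_rpow_of_nonneg]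
    rw [← h4]
    positivity
  have h5 : eLpNorm (posPart W k') s (volume.restrict (ball 0 r)) ≤
      eLpNorm (posPart W k) s (volume.restrict (ball 0 r)) := by
    refine eLpNorm_mono_real fun x => ?_
    rw [Real.norm_of_nonneg (posPart_nonneg _ _ _)]
    exact posPart_mono W hk.le x
  refine h1.trans ((mul_le_mul' (hgain.trans (mul_le_mul_right h5 _)) h3).trans (le_of_eq ?_))
  ring

/-- The local maximum principle in the De Giorgi class. -/
lemma exists_sup_bound {q q' : ℝ} (hc : q.HolderConjugate q') {s t P : ℝ≥0} (hs : (s : ℝ) = 2 * q')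
    (ht1 : 1 ≤ t) (ht2 : t < 2) (htn : t < n) (hP : (t : ℝ)⁻¹ - (n : ℝ)⁻¹ ≤ (P : ℝ)⁻¹) (hsP : s < P)
    {C : ℝ} (hC : 0 ≤ C) {Λ : ℝ≥0∞} (hΛ : Λ ≠ ⊤) :
    ∃ ε : ℝ≥0∞, 0 < ε ∧ ∀ (G : E n → ℝ≥0∞) (W : E n → ℝ), IsWeight q Λ G → DeGiorgi C G W →
      eLpNorm (posPart W 0) s (volume.restrict (ball 0 (1 / 2))) ≤ ε →
      ∀ x ∈ ball (0 : E n) (1 / 4), W x ≤ 1 / 2 := by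
  have hs0 : 0 < s := by
    have := hc.symm.pos
    rw [← NNReal.coe_pos, hs]
    positivity
  have hs0' : (0 : ℝ) < s := by exact_mod_cast hs0
  have hP0' : (0 : ℝ) < P := by exact_mod_cast hs0.trans hsP
  have hsP' : (s : ℝ) < P := by exact_mod_cast hsP
  have hθ0 : 0 < 1 - (s : ℝ) / P := by
    rw [sub_pos, div_lt_one hP0']
    exact hsP'
  have hθ1 : 1 - (s : ℝ) / P ≤ 1 := by
    have : 0 ≤ (s : ℝ) / P := by positivity
    linarith
  obtain ⟨A, hA, hgain⟩ := exists_gain (n := n) hc hs ht1 ht2 htn hP hC hΛ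
  obtain ⟨ε, hε, hrec⟩ := exists_tendsto_zero_of_recursion (M := A * 32) (by finiteness) hθ0
  refine ⟨ε, hε, fun G W hG hW h0 => ?_⟩
  obtain ⟨K, hK⟩ := hW.lipschitz
  have hcont : Continuous (posPart W (1 / 2)) := (lipschitzWith_posPart hK _).continuous
  -- Levels rise from `0` to `1/2` while the radii `ρ j` shrink from `1/2` to `1/4`.
  set κ : ℕ → ℝ := fun j => (1 - (1 / 2) ^ j) / 2 with hκ
  set ρ : ℕ → ℝ := fun j => 1 / 4 + (1 / 2) ^ j / 4 with hρ
  set y : ℕ → ℝ≥0∞ := fun j => eLpNorm (posPart W (κ j)) s (volume.restrict (ball 0 (ρ j))) with hy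
  have hy0 : y 0 ≤ ε := by
    simp only [hy, hκ, hρ]
    norm_num at h0 ⊢
    exact h0
  have hstep : ∀ j, y (j + 1) ≤ A * 32 * 4 ^ j * y j * y j ^ (1 - (s : ℝ) / P) := by
    intro j
    have hp : (0 : ℝ) < (1 / 2) ^ j := by positivity
    have hp1 : (1 / 2 : ℝ) ^ j ≤ 1 := pow_le_one₀ (by norm_num) (by norm_num)
    have e1 : κ (j + 1) - κ j = (1 / 2) ^ j / 4 := by simp only [hκ, pow_succ]; ring
    have e2 : ρ j - ρ (j + 1) = (1 / 2) ^ j / 8 := by simp only [hρ, pow_succ]; ring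
    have hρlt : ρ (j + 1) < ρ j := by linarith
    have hρpos : 0 < ρ (j + 1) := by simp only [hρ]; positivity
    have hρle : ρ j ≤ 1 := by simp only [hρ]; linarith
    have h1 := eLpNorm_posPart_step hs0 hsP hK.continuous (k := κ j) (by linarith) hρlt
      (hgain G W hG hW (κ (j + 1)) _ _ hρpos hρlt hρle)
    refine h1.trans ?_
    change _ * y j * y j ^ (1 - (s : ℝ) / P) ≤ _
    refine mul_le_mul_left (mul_le_mul_left ?_ _) _
    have e3 : ((1 / 2 : ℝ) ^ j / 8)⁻¹ = 8 * 2 ^ j := by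
      rw [inv_div, one_div, inv_pow, div_inv_eq_mul]
    have e4 : ((1 / 2 : ℝ) ^ j / 4)⁻¹ = 4 * 2 ^ j := by
      rw [inv_div, one_div, inv_pow, div_inv_eq_mul]
    rw [e1, e2, e3, e4]
    -- The level gap contributes at most `4 * 2 ^ j` and the radius gap `8 * 2 ^ j`; together they
    -- give `32 * 4 ^ j`.
    have h2 : ENNReal.ofReal (4 * 2 ^ j) ^ (1 - (s : ℝ) / P) ≤ ENNReal.ofReal (4 * 2 ^ j) := by
      refine (ENNReal.rpow_le_rpow_of_exponent_le ?_ hθ1).trans (ENNReal.rpow_one _).le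
      rw [← ENNReal.ofReal_one]
      refine ENNReal.ofReal_le_ofReal ?_
      have : (1 : ℝ) ≤ 2 ^ j := one_le_pow₀ (by norm_num)
      linarith
    refine (mul_le_mul_right h2 _).trans (le_of_eq ?_)
    rw [mul_assoc, ← ENNReal.ofReal_mul (by positivity), mul_assoc A]
    congr 1
    have e5 : (8 * 2 ^ j * (4 * 2 ^ j) : ℝ) = 32 * 4 ^ j := by
      rw [show (4 : ℝ) = 2 * 2 by norm_num, mul_pow]
      ring
    rw [e5, ENNReal.ofReal_mul (by norm_num), ENNReal.ofReal_pow (by norm_num)]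
    norm_num
  have hlim := hrec y hstep hy0
  have hzero : eLpNorm (posPart W (1 / 2)) s (volume.restrict (ball 0 (1 / 4))) = 0 := by
    refine le_antisymm (ge_of_tendsto' hlim fun j => ?_) zero_le
    have hp : (0 : ℝ) < (1 / 2) ^ j := by positivity
    have hsub : ball (0 : E n) (1 / 4) ⊆ ball 0 (ρ j) :=
      ball_subset_ball (by simp only [hρ]; linarith)
    refine (eLpNorm_mono_measure _ (Measure.restrict_mono hsub le_rfl)).trans
      (eLpNorm_mono_real fun x => ?_)
    rw [Real.norm_of_nonneg (posPart_nonneg _ _ _)]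
    refine posPart_mono W ?_ x
    simp only [hκ]
    linarith
  rw [eLpNorm_eq_zero_iff hcont.aestronglyMeasurable (by exact_mod_cast hs0.ne')] at hzero
  -- Continuity upgrades vanishing almost everywhere to vanishing at every point of the ball.
  have heq := Measure.eqOn_open_of_ae_eq hzero isOpen_ball hcont.continuousOn continuousOn_const
  intro x hx
  have h1 : posPart W (1 / 2) x = 0 := heq hx
  have h2 : W x - 1 / 2 ≤ posPart W (1 / 2) x := le_max_left _ _
  linarith

/-! ### Isoperimetric inequality and measure-to-pointwise estimate -/

/-- A form of De Giorgi's isoperimetric inequality. -/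
lemma isoperimetric {W : E n → ℝ} {K : ℝ≥0} (hW : LipschitzWith K W) {k d : ℝ} (hd : 0 < d)
    (r : ℝ) :
    ENNReal.ofReal d * volume ({x | k + d ≤ W x} ∩ ball 0 r) * volume ({x | W x ≤ k} ∩ ball 0 r) ≤
      ENNReal.ofReal (2 * r) * (2 ^ n * volume (ball (0 : E n) r)) *
        (volume ({x | k < W x ∧ W x < k + d} ∩ ball 0 r) ^ (1 / 2 : ℝ) *
          (∫⁻ x in ball (0 : E n) r, ‖fderiv ℝ (posPart W k) x‖ₑ ^ 2) ^ (1 / 2 : ℝ)) := by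
  set B := ball (0 : E n) r
  have hWc := hW.continuous
  -- The two-sided truncation differs by exactly `d` between the high and low sets, bounding the
  -- Poincaré double integral from below. Its gradient lives only on the intermediate slab, where
  -- Cauchy–Schwarz yields the square root of the slab's measure.
  obtain ⟨z, hz⟩ : ∃ z : E n → ℝ, z = fun x => min (posPart W k x) d := ⟨_, rfl⟩
  have hzl : LipschitzWith K z := by rw [hz]; exact (lipschitzWith_posPart hW k).min_const d
  have hz_low : ∀ x, W x ≤ k → z x = 0 := fun x hx => by
    rw [hz]
    simp [posPart, max_eq_right (sub_nonpos.2 hx), hd.le]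
  have hz_high : ∀ x, k + d ≤ W x → z x = d := fun x hx => by
    rw [hz]
    exact min_eq_right (le_max_of_le_left (by linarith))
  have hz0 : ∀ x, 0 ≤ z x := fun x => by rw [hz]; exact le_min (posPart_nonneg _ _ _) hd.le
  have hzd : ∀ x, z x ≤ d := fun x => by rw [hz]; exact min_le_right _ _
  have hE : MeasurableSet ({x | k + d ≤ W x} ∩ B) :=
    (isClosed_le continuous_const hWc).measurableSet.inter measurableSet_ball
  have hF : MeasurableSet ({x | W x ≤ k} ∩ B) :=
    (isClosed_le hWc continuous_const).measurableSet.inter measurableSet_ball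
  have hA : MeasurableSet {x | k < W x ∧ W x < k + d} :=
    ((isOpen_lt continuous_const hWc).inter (isOpen_lt hWc continuous_const)).measurableSet
  have h1 : ENNReal.ofReal d * volume ({x | k + d ≤ W x} ∩ B) * volume ({x | W x ≤ k} ∩ B) ≤
      ∫⁻ x in B, ∫⁻ y in B, ‖z x - z y‖ₑ := by
    calc _ = ∫⁻ x in {x | k + d ≤ W x} ∩ B, ∫⁻ y in {x | W x ≤ k} ∩ B, ENNReal.ofReal d := by
          rw [setLIntegral_const, setLIntegral_const]; ring
      _ ≤ ∫⁻ x in {x | k + d ≤ W x} ∩ B, ∫⁻ y in {x | W x ≤ k} ∩ B, ‖z x - z y‖ₑ := by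
          refine setLIntegral_mono' hE fun x hx => setLIntegral_mono' hF fun y hy => ?_
          rw [hz_high x hx.1, hz_low y hy.1, sub_zero, Real.enorm_of_nonneg hd.le]
      _ ≤ _ := by
          refine (lintegral_mono_set inter_subset_right).trans (lintegral_mono fun x => ?_)
          exact lintegral_mono_set inter_subset_right
  have h2 : ∫⁻ x in B, ‖fderiv ℝ z x‖ₑ ≤
      volume ({x | k < W x ∧ W x < k + d} ∩ B) ^ (1 / 2 : ℝ) *
        (∫⁻ x in B, ‖fderiv ℝ (posPart W k) x‖ₑ ^ 2) ^ (1 / 2 : ℝ) := by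
    have e1 : ∀ x, ‖fderiv ℝ z x‖ₑ ≤
        (({x | k < W x ∧ W x < k + d}.indicator fun _ => (1 : ℝ≥0∞)) *
          fun x => ‖fderiv ℝ (posPart W k) x‖ₑ) x := by
      intro x
      rw [Pi.mul_apply]
      have hzero : fderiv ℝ z x = 0 → ‖fderiv ℝ z x‖ₑ = 0 := fun h => by
        rw [h, ← ofReal_norm, norm_zero, ENNReal.ofReal_zero]
      rcases le_or_gt (W x) k with h | h
      · rw [hzero (fderiv_eq_zero_of_nonneg hz0 (hz_low x h))]
        exact zero_le
      rcases le_or_gt (k + d) (W x) with h' | h'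
      · rw [hzero (IsLocalMax.fderiv_eq_zero (Eventually.of_forall fun y => by
          rw [hz_high x h']; exact hzd y))]
        exact zero_le
      · rw [indicator_of_mem (show x ∈ {x | k < W x ∧ W x < k + d} from ⟨h, h'⟩), one_mul]
        have : z =ᶠ[𝓝 x] posPart W k := by
          filter_upwards [hWc.continuousAt.eventually (gt_mem_nhds h')] with y hy
          rw [hz]
          exact min_eq_left (max_le (by linarith) hd.le)
        rw [this.fderiv_eq]
    refine (lintegral_mono e1).trans ((ENNReal.lintegral_mul_le_Lp_mul_Lq _ (p := 2) (q := 2)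
      Real.HolderConjugate.two_two (measurable_const.indicator hA).aemeasurable
      (measurable_fderiv ℝ _).enorm.aemeasurable).trans (le_of_eq ?_))
    have e2 : ∀ x, ({x | k < W x ∧ W x < k + d}.indicator (fun _ => (1 : ℝ≥0∞)) x) ^ (2 : ℝ) =
        {x | k < W x ∧ W x < k + d}.indicator (fun _ => (1 : ℝ≥0∞)) x := by
      intro x
      by_cases hx : x ∈ {x | k < W x ∧ W x < k + d}
      · rw [indicator_of_mem hx, ENNReal.one_rpow]
      · rw [indicator_of_notMem hx, ENNReal.zero_rpow_of_pos (by norm_num)]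
    simp_rw [e2, ENNReal.rpow_two]
    rw [lintegral_indicator_const hA, Measure.restrict_apply hA, one_mul]
  exact h1.trans ((poincare_lipschitz hzl).trans (mul_le_mul_right h2 _))

lemma IsWeight.lintegral_le_const {q q' : ℝ} (hc : q.HolderConjugate q') {Λ : ℝ≥0∞}
    {G : E n → ℝ≥0∞} (hG : IsWeight q Λ G) :
    ∫⁻ x in ball 0 1, G x ≤ Λ * volume (ball (0 : E n) 1) ^ (1 / q') := by
  have h := ENNReal.lintegral_mul_le_Lp_mul_Lq _ hc hG.aemeasurable
    (aemeasurable_const (b := (1 : ℝ≥0∞)))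
  simp only [Pi.mul_apply, mul_one, ENNReal.one_rpow, lintegral_const, Measure.restrict_apply_univ,
    one_mul] at h
  exact h.trans (mul_le_mul_left hG.lintegral_le _)

/-- The level sets of a member of the De Giorgi class that is at most `1` become small. -/
lemma exists_level_set_small {q q' : ℝ} (hc : q.HolderConjugate q') (C : ℝ)
    {Λ : ℝ≥0∞} (hΛ : Λ ≠ ⊤) {δ : ℝ≥0∞} (hδ : 0 < δ) :
    ∃ J : ℕ, ∀ (G : E n → ℝ≥0∞) (W : E n → ℝ), IsWeight q Λ G → DeGiorgi C G W →
      (∀ x ∈ ball (0 : E n) 1, W x ≤ 1) →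
      volume (ball (0 : E n) (1 / 2)) ≤ 2 * volume ({x | W x ≤ 0} ∩ ball 0 (1 / 2)) →
      volume ({x | 1 - (1 / 2) ^ J ≤ W x} ∩ ball 0 (1 / 2)) ≤ δ := by
  set β := volume (ball (0 : E n) (1 / 2)) with hβ
  have hβ0 : β ≠ 0 := (measure_ball_pos _ _ (by norm_num)).ne'
  have hβt : β ≠ ⊤ := measure_ball_lt_top.ne
  set Λ' := Λ * volume (ball (0 : E n) 1) ^ (1 / q')
  have hΛ' : Λ' ≠ ⊤ := by
    refine ENNReal.mul_ne_top hΛ (ENNReal.rpow_ne_top_of_nonneg ?_ measure_ball_lt_top.ne)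
    have := hc.symm.pos
    positivity
  set Q : ℝ≥0∞ := ENNReal.ofReal (2 * (1 / 2)) * (2 ^ n * β) *
    (ENNReal.ofReal (C / (1 - 1 / 2) ^ 2) * (4 * Λ')) ^ (1 / 2 : ℝ)
  have hQ : Q ≠ ⊤ := by
    have : (ENNReal.ofReal (C / (1 - 1 / 2) ^ 2) * (4 * Λ')) ^ (1 / 2 : ℝ) ≠ ⊤ :=
      ENNReal.rpow_ne_top_of_nonneg (by norm_num) (by finiteness)
    finiteness
  set δ' := min δ 1
  have hδ' : δ' ≠ 0 := (lt_min hδ one_pos).ne'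
  -- Pigeonhole: if the top level set were larger than `δ`, each of the `J` disjoint slabs `A j`
  -- would have measure bounded below, and together they would exceed the measure `β` of the ball.
  obtain ⟨J, hJ⟩ := ENNReal.exists_nat_mul_gt (a := (β * δ') ^ 2) (b := (2 * Q) ^ 2 * β)
    (pow_ne_zero _ (mul_ne_zero hβ0 hδ')) (by finiteness)
  refine ⟨J, fun G W hG hW hW1 hhalf => ?_⟩
  obtain ⟨K, hK⟩ := hW.lipschitz
  have hWc := hK.continuous
  set A : ℕ → Set (E n) := fun j =>
    {x | 1 - (1 / 2) ^ j < W x ∧ W x < 1 - (1 / 2) ^ (j + 1)} ∩ ball 0 (1 / 2) with hA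
  set e := volume ({x | 1 - (1 / 2) ^ J ≤ W x} ∩ ball (0 : E n) (1 / 2)) with he
  have hstep : ∀ j < J, (β * e) ^ 2 ≤ (2 * Q) ^ 2 * volume (A j) := by
    intro j hj
    have hp : (0 : ℝ) < (1 / 2) ^ (j + 1) := by positivity
    have hpj : (1 / 2 : ℝ) ^ j = 2 * (1 / 2) ^ (j + 1) := by rw [pow_succ]; ring
    have hp1 : (1 / 2 : ℝ) ^ j ≤ 1 := pow_le_one₀ (by norm_num) (by norm_num)
    have hadd : 1 - (1 / 2 : ℝ) ^ j + (1 / 2) ^ (j + 1) = 1 - (1 / 2) ^ (j + 1) := by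
      rw [hpj]; ring
    have hiso := isoperimetric hK (k := 1 - (1 / 2) ^ j) hp (1 / 2)
    rw [hadd] at hiso
    -- As `W ≤ 1`, the truncation is at most twice the slab height, so the energy is of order height
    -- squared. The height then cancels from the isoperimetric inequality, leaving a bound uniform
    -- in `j`.
    have hen : ∫⁻ x in ball (0 : E n) (1 / 2), ‖fderiv ℝ (posPart W (1 - (1 / 2) ^ j)) x‖ₑ ^ 2 ≤
        ENNReal.ofReal ((1 / 2) ^ (j + 1)) ^ 2 *
          (ENNReal.ofReal (C / (1 - 1 / 2) ^ 2) * (4 * Λ')) := by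
      refine (hW.energy _ _ _ (by norm_num) (by norm_num) le_rfl).trans ?_
      have h1 : ∫⁻ x in ball (0 : E n) 1, G x *
          ENNReal.ofReal (posPart W (1 - (1 / 2) ^ j) x) ^ 2 ≤
          ∫⁻ x in ball (0 : E n) 1, G x * (4 * ENNReal.ofReal ((1 / 2) ^ (j + 1)) ^ 2) := by
        refine setLIntegral_mono' measurableSet_ball fun x hx => mul_le_mul_right ?_ _
        have : posPart W (1 - (1 / 2) ^ j) x ≤ 2 * (1 / 2) ^ (j + 1) := by
          refine max_le ?_ (by positivity)
          linarith [hW1 x hx]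
        refine (pow_le_pow_left₀ zero_le (ENNReal.ofReal_le_ofReal this) 2).trans (le_of_eq ?_)
        rw [ENNReal.ofReal_mul (by norm_num), mul_pow]
        norm_num
      rw [lintegral_mul_const' _ _ (by finiteness)] at h1
      calc _ ≤ ENNReal.ofReal (C / (1 - 1 / 2) ^ 2) *
            (Λ' * (4 * ENNReal.ofReal ((1 / 2) ^ (j + 1)) ^ 2)) :=
            mul_le_mul_right (h1.trans (mul_le_mul_left (hG.lintegral_le_const hc) _)) _
        _ = _ := by ring
    have hen' := ENNReal.rpow_le_rpow hen (show (0 : ℝ) ≤ 1 / 2 by norm_num)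
    rw [ENNReal.mul_rpow_of_nonneg _ _ (by norm_num), ← ENNReal.rpow_natCast,
      ← ENNReal.rpow_mul] at hen'
    rw [show ((2 : ℕ) : ℝ) * (1 / 2) = 1 by norm_num, ENNReal.rpow_one] at hen'
    have hE : e ≤ volume ({x | 1 - (1 / 2) ^ (j + 1) ≤ W x} ∩ ball (0 : E n) (1 / 2)) := by
      refine measure_mono (inter_subset_inter_left _ fun x hx => ?_)
      rw [mem_ofPred_eq] at hx ⊢
      have : (1 / 2 : ℝ) ^ J ≤ (1 / 2) ^ (j + 1) :=
        pow_le_pow_of_le_one (by norm_num) (by norm_num) hj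
      linarith
    have hF : volume ({x | W x ≤ 0} ∩ ball (0 : E n) (1 / 2)) ≤
        volume ({x | W x ≤ 1 - (1 / 2) ^ j} ∩ ball (0 : E n) (1 / 2)) := by
      refine measure_mono (inter_subset_inter_left _ fun x hx => ?_)
      rw [mem_ofPred_eq] at hx ⊢
      linarith
    have hdt : ENNReal.ofReal ((1 / 2) ^ (j + 1)) ≠ 0 := by simp
    have hmain : ENNReal.ofReal ((1 / 2) ^ (j + 1)) * (β * e) ≤
        ENNReal.ofReal ((1 / 2) ^ (j + 1)) * (2 * Q * volume (A j) ^ (1 / 2 : ℝ)) := by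
      calc _ ≤ ENNReal.ofReal ((1 / 2) ^ (j + 1)) * (2 *
            volume ({x | W x ≤ 1 - (1 / 2) ^ j} ∩ ball (0 : E n) (1 / 2)) *
            volume ({x | 1 - (1 / 2) ^ (j + 1) ≤ W x} ∩ ball (0 : E n) (1 / 2))) :=
            mul_le_mul_right (mul_le_mul' (hhalf.trans (mul_le_mul_right hF _)) hE) _
        _ = 2 * (ENNReal.ofReal ((1 / 2) ^ (j + 1)) *
            volume ({x | 1 - (1 / 2) ^ (j + 1) ≤ W x} ∩ ball (0 : E n) (1 / 2)) *
            volume ({x | W x ≤ 1 - (1 / 2) ^ j} ∩ ball (0 : E n) (1 / 2))) := by ring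
        _ ≤ _ := mul_le_mul_right (hiso.trans (mul_le_mul_right (mul_le_mul_right hen' _) _)) _
        _ = _ := by
            simp only [Q, hA]
            ring
    rw [ENNReal.mul_le_mul_iff_right hdt ENNReal.ofReal_ne_top] at hmain
    refine (pow_le_pow_left₀ zero_le hmain 2).trans (le_of_eq ?_)
    rw [mul_pow, ← ENNReal.rpow_natCast (volume (A j) ^ (1 / 2 : ℝ)), ← ENNReal.rpow_mul]
    norm_num
  have hsum : (J : ℝ≥0∞) * (β * e) ^ 2 ≤ (2 * Q) ^ 2 * β := by
    have hdisj : Pairwise (Function.onFun Disjoint A) := by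
      have hlt : ∀ i j : ℕ, i < j → Disjoint (A i) (A j) := by
        intro i j hij
        rw [Set.disjoint_left]
        intro x hx hx'
        have h1 := hx.1.2
        have h2 := hx'.1.1
        have : (1 / 2 : ℝ) ^ j ≤ (1 / 2) ^ (i + 1) :=
          pow_le_pow_of_le_one (by norm_num) (by norm_num) hij
        linarith
      intro i j hij
      rcases lt_or_gt_of_ne hij with h | h
      · exact hlt i j h
      · exact (hlt j i h).symm
    have hAm : ∀ j, MeasurableSet (A j) := fun j =>
      ((isOpen_lt continuous_const hWc).inter (isOpen_lt hWc continuous_const)).measurableSet.inter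
        measurableSet_ball
    calc (J : ℝ≥0∞) * (β * e) ^ 2 = ∑ j ∈ Finset.range J, (β * e) ^ 2 := by simp
      _ ≤ ∑ j ∈ Finset.range J, (2 * Q) ^ 2 * volume (A j) :=
          Finset.sum_le_sum fun j hj => hstep j (Finset.mem_range.1 hj)
      _ = (2 * Q) ^ 2 * volume (⋃ j ∈ Finset.range J, A j) := by
          rw [← Finset.mul_sum, measure_biUnion_finset (fun i _ j _ hij => hdisj hij)
            fun j _ => hAm j]
      _ ≤ _ := mul_le_mul_right (measure_mono (iUnion₂_subset fun j _ => inter_subset_right)) _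
  by_contra hcon
  have hlt : δ' ≤ e := (min_le_left _ _).trans (not_le.1 hcon).le
  have : (J : ℝ≥0∞) * (β * δ') ^ 2 ≤ J * (β * e) ^ 2 := by gcongr
  exact absurd (hJ.trans_le (this.trans hsum)) (lt_irrefl _)

/-- A member of the De Giorgi class that is at most `1` in the unit ball and nonpositive on half of
the ball of radius `1 / 2` is strictly below `1` near the origin. -/
lemma exists_density_bound (hn : 2 ≤ n) {q : ℝ} (hq : (n : ℝ) / 2 < q) {C : ℝ} (hC : 0 ≤ C)
    {Λ : ℝ≥0∞} (hΛ : Λ ≠ ⊤) :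
    ∃ θ : ℝ, 0 < θ ∧ θ < 1 ∧ ∀ (G : E n → ℝ≥0∞) (W : E n → ℝ), IsWeight q Λ G → DeGiorgi C G W →
      (∀ x ∈ ball (0 : E n) 1, W x ≤ 1) →
      volume (ball (0 : E n) (1 / 2)) ≤ 2 * volume ({x | W x ≤ 0} ∩ ball 0 (1 / 2)) →
      ∀ x ∈ ball (0 : E n) (1 / 4), W x ≤ 1 - θ := by
  obtain ⟨q', hc, s, t, P, hs, ht1, ht2, htn, hP, hsP⟩ := exists_exponents hn hq
  obtain ⟨ε, hε, hsup⟩ := exists_sup_bound hc hs ht1 ht2 htn hP hsP hC hΛ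
  have hs0 : (0 : ℝ) < s := by
    have := hc.symm.pos
    rw [hs]
    positivity
  have hs0' : (s : ℝ≥0∞) ≠ 0 := by
    have : s ≠ 0 := by
      rintro rfl
      simp at hs0
    exact_mod_cast this
  -- The `s`-th power makes the `L^s` norm of the indicator of a set of this measure at most `ε`.
  have hδ : 0 < min ε 1 ^ (s : ℝ) :=
    ENNReal.rpow_pos (lt_min hε one_pos) ((min_le_right _ _).trans_lt ENNReal.one_lt_top).ne
  obtain ⟨J, hJ⟩ := exists_level_set_small (n := n) hc C hΛ hδ
  have hp1 : (1 / 2 : ℝ) ^ J ≤ 1 := pow_le_one₀ (by norm_num) (by norm_num)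
  have hp0 : (0 : ℝ) < (1 / 2) ^ J := by positivity
  -- The maximum principle is applied to `2^J (W - (1 - 2^(-J)))`, whose positive part is at most
  -- the indicator of `T` on the half ball. Its bound `1/2` leaves half of the top layer `2^(-J)` as
  -- `θ`.
  refine ⟨(1 / 2) ^ J / 2, by positivity, by linarith, fun G W hG hW hW1 hhalf x hx => ?_⟩
  have hsmall := hJ G W hG hW hW1 hhalf
  set T := {x | 1 - (1 / 2) ^ J ≤ W x} ∩ ball (0 : E n) (1 / 2)
  obtain ⟨K, hK⟩ := hW.lipschitz
  have hTm : MeasurableSet T :=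
    (isClosed_le continuous_const hK.continuous).measurableSet.inter measurableSet_ball
  have hinv : ((1 / 2 : ℝ) ^ J)⁻¹ * (1 / 2) ^ J = 1 := inv_mul_cancel₀ hp0.ne'
  have hbound := hsup G _ hG (hW.affine (inv_pos.2 hp0) (1 - (1 / 2) ^ J)) ?_ x hx
  · have h2 := mul_le_mul_of_nonneg_left hbound hp0.le
    rw [← mul_assoc, mul_inv_cancel₀ hp0.ne', one_mul] at h2
    linarith
  · have h1 : eLpNorm (posPart (fun x => ((1 / 2 : ℝ) ^ J)⁻¹ * (W x - (1 - (1 / 2) ^ J))) 0) s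
        (volume.restrict (ball 0 (1 / 2))) ≤
        eLpNorm (T.indicator fun _ => (1 : ℝ)) s (volume.restrict (ball 0 (1 / 2))) := by
      refine eLpNorm_mono_ae_real ?_
      filter_upwards [ae_restrict_mem measurableSet_ball] with y hy
      rw [Real.norm_of_nonneg (posPart_nonneg _ _ _)]
      by_cases hyT : y ∈ T
      · rw [indicator_of_mem hyT]
        refine max_le ?_ zero_le_one
        rw [sub_zero]
        calc _ ≤ ((1 / 2 : ℝ) ^ J)⁻¹ * (1 / 2) ^ J := by
              refine mul_le_mul_of_nonneg_left ?_ (inv_pos.2 hp0).le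
              linarith [hW1 y (ball_subset_ball (by norm_num) hy)]
          _ = 1 := hinv
      · rw [indicator_of_notMem hyT]
        refine le_of_eq (max_eq_right ?_)
        have : W y < 1 - (1 / 2) ^ J := by
          by_contra h
          exact hyT ⟨not_lt.1 h, hy⟩
        rw [sub_zero]
        exact mul_nonpos_of_nonneg_of_nonpos (inv_pos.2 hp0).le (by linarith)
    refine h1.trans ?_
    rw [eLpNorm_indicator_const hTm hs0' ENNReal.coe_ne_top]
    simp only [enorm_one, one_mul, ENNReal.coe_toReal]
    refine (ENNReal.rpow_le_rpow ((Measure.restrict_apply_le _ _).trans hsmall)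
      (by positivity)).trans ?_
    rw [← ENNReal.rpow_mul, mul_one_div_cancel hs0.ne', ENNReal.rpow_one]
    exact min_le_left _ _

/-! ### Decay of the oscillation -/

lemma osc_le {Ω : Set (E n)} (hΩ : Ω.Nonempty) {u : E n → ℝ} {l h : ℝ} (hl : ∀ x ∈ Ω, l ≤ u x)
    (hh : ∀ x ∈ Ω, u x ≤ h) : osc Ω u ≤ h - l := by
  have h1 : sSup (u '' Ω) ≤ h := csSup_le (hΩ.image u) (by rintro _ ⟨x, hx, rfl⟩; exact hh x hx)
  have h2 : l ≤ sInf (u '' Ω) := le_csInf (hΩ.image u) (by rintro _ ⟨x, hx, rfl⟩; exact hl x hx)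
  unfold osc
  linarith

lemma le_sSup_of_abs_le {Ω : Set (E n)} {u : E n → ℝ} {M : ℝ} (hM : ∀ x, |u x| ≤ M) {x : E n}
    (hx : x ∈ Ω) : u x ≤ sSup (u '' Ω) :=
  le_csSup ⟨M, by rintro _ ⟨y, -, rfl⟩; exact (abs_le.1 (hM y)).2⟩ (mem_image_of_mem u hx)

lemma sInf_le_of_abs_le {Ω : Set (E n)} {u : E n → ℝ} {M : ℝ} (hM : ∀ x, |u x| ≤ M) {x : E n}
    (hx : x ∈ Ω) : sInf (u '' Ω) ≤ u x :=
  csInf_le ⟨-M, by rintro _ ⟨y, -, rfl⟩; exact (abs_le.1 (hM y)).1⟩ (mem_image_of_mem u hx)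

lemma osc_mono {Ω Ω' : Set (E n)} (hΩ : Ω.Nonempty) (h : Ω ⊆ Ω') {u : E n → ℝ} {M : ℝ}
    (hM : ∀ x, |u x| ≤ M) : osc Ω u ≤ osc Ω' u :=
  osc_le hΩ (fun _ hx => sInf_le_of_abs_le hM (h hx)) fun _ hx => le_sSup_of_abs_le hM (h hx)

lemma osc_nonneg {Ω : Set (E n)} (hΩ : Ω.Nonempty) {u : E n → ℝ} {M : ℝ}
    (hM : ∀ x, |u x| ≤ M) : 0 ≤ osc Ω u := by
  obtain ⟨x, hx⟩ := hΩ
  exact sub_nonneg.2 ((sInf_le_of_abs_le hM hx).trans (le_sSup_of_abs_le hM hx))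

lemma osc_congr {Ω Ω' : Set (E n)} {u v : E n → ℝ} (h : EqOn u v Ω') (hΩ : Ω ⊆ Ω') :
    osc Ω u = osc Ω v := by
  simp only [osc, (h.mono hΩ).image_eq]

lemma weakForm_congr {a : E n → Matrix (Fin n) (Fin n) ℝ} {b : E n → E n} {Ω : Set (E n)}
    (hΩ : IsOpen Ω) {u v : E n → ℝ} (h : EqOn u v Ω) (η : E n → ℝ) :
    weakForm a b Ω u η = weakForm a b Ω v η := by
  rw [weakForm_eq, weakForm_eq]
  refine setIntegral_congr_fun hΩ.measurableSet fun x hx => ?_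
  have : fderiv ℝ u x = fderiv ℝ v x := (h.eventuallyEq_of_mem (hΩ.mem_nhds hx)).fderiv_eq
  simp only [this]

lemma weakForm_neg (a : E n → Matrix (Fin n) (Fin n) ℝ) (b : E n → E n) (Ω : Set (E n))
    (u η : E n → ℝ) : weakForm a b Ω (fun x => -u x) η = -weakForm a b Ω u η := by
  have hD : ∀ i x, D i (fun x => -u x) x = -D i u x := fun i x => by
    simp [D, fderiv_fun_neg]
  simp only [weakForm, hD]
  rw [← integral_neg]
  congr 1
  ext x
  simp only [mul_neg, neg_mul, Finset.sum_neg_distrib]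
  ring

/-- A Lipschitz function on a bounded set has a bounded globally Lipschitz extension. -/
lemma exists_bounded_extension {R : ℝ} {u : E n → ℝ} {K : ℝ≥0}
    (hu : LipschitzOnWith K u (ball 0 R)) :
    ∃ U M, LipschitzWith K U ∧ (∀ x, |U x| ≤ M) ∧ EqOn u U (ball 0 R) := by
  obtain ⟨g, hg, hgu⟩ := hu.extend_real
  obtain ⟨M, hM⟩ := (isCompact_closedBall (0 : E n) R).exists_bound_of_continuousOn
    hg.continuous.continuousOn
  have h0 : ∀ x ∈ ball (0 : E n) R, |g x| ≤ |M| := fun x hx =>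
    (hM x (ball_subset_closedBall hx)).trans (le_abs_self M)
  refine ⟨fun x => max (min (g x) |M|) (-|M|), |M|, (hg.min_const _).max_const _, fun x => ?_,
    fun x hx => ?_⟩
  · rw [abs_le]
    exact ⟨le_max_right _ _, max_le (min_le_right _ _) (by linarith [abs_nonneg M])⟩
  · have := abs_le.1 (h0 x hx)
    change u x = max (min (g x) |M|) (-|M|)
    rw [hgu hx, min_eq_left this.2, max_eq_left this.1]

/-- The decay of the oscillation for a function which together with its negative belongs to the
De Giorgi class. -/
lemma osc_decay_of_deGiorgi {q C θ : ℝ} {Λ : ℝ≥0∞}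
    (hθ : ∀ (G : E n → ℝ≥0∞) (W : E n → ℝ), IsWeight q Λ G → DeGiorgi C G W →
      (∀ x ∈ ball (0 : E n) 1, W x ≤ 1) →
      volume (ball (0 : E n) (1 / 2)) ≤ 2 * volume ({x | W x ≤ 0} ∩ ball 0 (1 / 2)) →
      ∀ x ∈ ball (0 : E n) (1 / 4), W x ≤ 1 - θ)
    {G : E n → ℝ≥0∞} (hG : IsWeight q Λ G) {W : E n → ℝ} (hW : DeGiorgi C G W)
    (hW' : DeGiorgi C G fun x => -W x) {l h : ℝ} (hl : ∀ x ∈ ball (0 : E n) 1, l ≤ W x)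
    (hh : ∀ x ∈ ball (0 : E n) 1, W x ≤ h) (hlh : l < h) :
    (∀ x ∈ ball (0 : E n) (1 / 4), W x ≤ h - θ / 2 * (h - l)) ∨
      ∀ x ∈ ball (0 : E n) (1 / 4), l + θ / 2 * (h - l) ≤ W x := by
  -- Multiplication by `c` sends half the range to `1`, so a function centred at its midrange meets
  -- the hypothesis of the density bound.
  set c := 2 / (h - l)
  have hd : 0 < h - l := by linarith
  have hc : 0 < c := by positivity
  have hcd : c * ((h - l) / 2) = 1 := by
    simp only [c]
    field_simp
  have key : ∀ (V : E n → ℝ) (m : ℝ), DeGiorgi C G V →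
      (∀ x ∈ ball (0 : E n) 1, V x ≤ m + (h - l) / 2) →
      volume (ball (0 : E n) (1 / 2)) ≤ 2 * volume ({x | V x ≤ m} ∩ ball 0 (1 / 2)) →
      ∀ x ∈ ball (0 : E n) (1 / 4), V x ≤ m + (h - l) / 2 - θ / 2 * (h - l) := by
    intro V m hV hV1 hvol x hx
    have hset : {x | c * (V x - m) ≤ 0} = {x | V x ≤ m} := by
      ext y
      simp only [mem_ofPred_eq]
      rw [mul_nonpos_iff_pos_imp_nonpos]
      constructor
      · intro h
        linarith [h.1 hc]
      · intro h
        exact ⟨fun _ => by linarith, fun _ => hc.le⟩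
    have := hθ G _ hG (hV.affine hc m) (fun y hy => ?_) (by rw [hset]; exact hvol) x hx
    · have h2 := mul_le_mul_of_nonneg_left this (show 0 ≤ (h - l) / 2 by positivity)
      rw [← mul_assoc, mul_comm _ c, hcd, one_mul] at h2
      linarith
    · rw [← hcd]
      refine mul_le_mul_of_nonneg_left ?_ hc.le
      linarith [hV1 y hy]
  -- The sets below and above the midrange cover the ball, so the larger has at least half its
  -- measure and decides whether `W` or `-W` is used.
  have hcover : volume (ball (0 : E n) (1 / 2)) ≤
      volume ({x | W x ≤ (l + h) / 2} ∩ ball 0 (1 / 2)) +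
      volume ({x | -W x ≤ -((l + h) / 2)} ∩ ball 0 (1 / 2)) := by
    refine (measure_mono fun x hx => ?_).trans (measure_union_le _ _)
    rcases le_total (W x) ((l + h) / 2) with h1 | h1
    · exact Or.inl ⟨h1, hx⟩
    · exact Or.inr ⟨neg_le_neg h1, hx⟩
  rcases le_total (volume ({x | W x ≤ (l + h) / 2} ∩ ball (0 : E n) (1 / 2)))
    (volume ({x | -W x ≤ -((l + h) / 2)} ∩ ball (0 : E n) (1 / 2))) with h1 | h1
  · right
    intro x hx
    have := key _ (-((l + h) / 2)) hW' (fun y hy => by linarith [hl y hy])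
      (hcover.trans (by rw [two_mul]; gcongr)) x hx
    linarith
  · left
    intro x hx
    have := key W ((l + h) / 2) hW (fun y hy => by linarith [hh y hy])
      (hcover.trans (by rw [two_mul]; gcongr)) x hx
    linarith

/-- The decay of the oscillation over concentric balls, one step. -/
lemma exists_osc_step (hn : 2 ≤ n) {ν : ℝ} (hν : 0 < ν) {q : ℝ} (hq : (n : ℝ) / 2 < q)
    (S : ℝ≥0) :
    ∃ κ : ℝ, 0 < κ ∧ κ < 1 ∧ ∀ (R₀ : ℝ) (a : E n → Matrix (Fin n) (Fin n) ℝ) (b : E n → E n),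
        UniformlyElliptic ν a (ball 0 R₀) →
        MemLp b (ENNReal.ofReal q) (volume.restrict (ball 0 R₀)) →
        DivNonpos b (ball 0 R₀) →
        (⨆ R ∈ Ioo (0 : ℝ) R₀, scaledNorm q b R) ≤ (S : ℝ≥0∞) →
        ∀ (U : E n → ℝ) (K : ℝ≥0) (M : ℝ), LipschitzWith K U → (∀ x, |U x| ≤ M) →
          (∀ η, IsTest (ball 0 R₀) η → weakForm a b (ball 0 R₀) U η = 0) →
          ∀ R, 0 < R → R < R₀ → osc (ball 0 (R * (1 / 4))) U ≤ κ * osc (ball 0 R) U := by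
  have hn' : (2 : ℝ) ≤ n := by exact_mod_cast hn
  have hq1 : 1 ≤ q := by linarith
  have hC : 0 ≤ 2 / ν * (2 * ν⁻¹ ^ 3 + 1) := by positivity
  have hΛ : volume (ball (0 : E n) 1) ^ (1 / q) + S ≠ ⊤ := by
    refine ENNReal.add_ne_top.2 ⟨ENNReal.rpow_ne_top_of_nonneg (by positivity)
      measure_ball_lt_top.ne, ENNReal.coe_ne_top⟩
  obtain ⟨θ, hθ0, hθ1, hθ⟩ := exists_density_bound hn hq hC hΛ
  refine ⟨1 - θ / 2, by linarith, by linarith, ?_⟩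
  intro R₀ a b ha hb hdiv hS U K M hU hM hweak R hR hRR
  have hfin : IsFiniteMeasure (volume.restrict (ball (0 : E n) R₀)) :=
    ⟨by rw [Measure.restrict_apply_univ]; exact measure_ball_lt_top⟩
  have hbint : IntegrableOn b (ball 0 R₀) :=
    hb.integrable (by rw [← ENNReal.ofReal_one]; exact ENNReal.ofReal_le_ofReal hq1)
  have hSR : scaledNorm q b R ≤ S :=
    (le_iSup₂ (f := fun R (_ : R ∈ Ioo (0 : ℝ) R₀) => scaledNorm q b R) R ⟨hR, hRR⟩).trans hS
  have hG : IsWeight q (volume (ball (0 : E n) 1) ^ (1 / q) + S)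
      fun x => 1 + ENNReal.ofReal R * ‖b (R • x)‖ₑ :=
    { aemeasurable := by
        refine (AEMeasurable.const_mul ?_ _).const_add _
        refine aemeasurable_comp_smul hR 1 (h := fun x => ‖b x‖ₑ) ?_
        rw [mul_one]
        exact (hb.1.mono_measure
          (Measure.restrict_mono (ball_subset_ball hRR.le) le_rfl)).enorm
      one_le := fun x => le_self_add
      lintegral_le := lintegral_weight_le hq1 hb.1 hR hRR hSR }
  have hW := deGiorgi_rescale hν ha hbint hdiv hU hM (fun η hη => (hweak η hη).le) hR hRR
  have hW' := deGiorgi_rescale hν ha hbint hdiv hU.neg (M := M) (fun x => by simpa using hM x)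
    (fun η hη => by
      have := weakForm_neg a b (ball 0 R₀) U η
      rw [hweak η hη, neg_zero] at this
      exact this.le) hR hRR
  have hsub : ball (0 : E n) (R * (1 / 4)) ⊆ ball 0 R := ball_subset_ball (by linarith)
  have hne : (ball (0 : E n) (R * (1 / 4))).Nonempty := nonempty_ball.2 (by positivity)
  have hscale : ∀ t, ∀ x ∈ ball (0 : E n) (R * t), R⁻¹ • x ∈ ball (0 : E n) t := by
    intro t x hx
    rw [mem_ball, dist_zero_right] at hx ⊢
    rwa [norm_smul, norm_inv, Real.norm_of_nonneg hR.le, inv_mul_lt_iff₀ hR]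
  have hunscale : ∀ x : E n, R • R⁻¹ • x = x := fun x => smul_inv_smul₀ hR.ne' x
  have hmem : ∀ x ∈ ball (0 : E n) 1, R • x ∈ ball (0 : E n) R := by
    intro x hx
    rw [mem_ball, dist_zero_right] at hx ⊢
    rw [norm_smul, Real.norm_of_nonneg hR.le]
    exact mul_lt_of_lt_one_right hR hx
  have hosc0 := osc_nonneg (hne.mono hsub) hM
  -- Zero oscillation is treated apart because the normalization divides by it.
  rcases hosc0.eq_or_lt with h0 | h0
  · rw [← h0, mul_zero, h0]
    exact osc_mono hne hsub hM
  · have hdec := osc_decay_of_deGiorgi hθ hG hW hW'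
      (fun x hx => sInf_le_of_abs_le hM (hmem x hx)) (fun x hx => le_sSup_of_abs_le hM (hmem x hx))
      (sub_pos.1 h0)
    change _ ≤ (1 - θ / 2) * (sSup (U '' ball 0 R) - sInf (U '' ball 0 R))
    rcases hdec with hd | hd
    · have h1 := osc_le hne (fun x hx => sInf_le_of_abs_le hM (hsub hx)) fun x hx => by
        have := hd _ (hscale _ x hx)
        rwa [hunscale] at this
      linarith
    · have h1 := osc_le hne (fun x hx => by
        have := hd _ (hscale _ x hx)
        rwa [hunscale] at this) fun x hx => le_sSup_of_abs_le hM (hsub hx)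
      linarith

/-- Geometric decay along the radii `R / 4 ^ k` gives decay with a power rate. -/
lemma le_rpow_of_geometric_decay {κ : ℝ} (hκ0 : 0 < κ) (hκ1 : κ < 1) :
    ∃ γ : ℝ, 0 < γ ∧ ∀ (R₀ : ℝ) (φ : ℝ → ℝ), (∀ ρ r, 0 < ρ → ρ ≤ r → φ ρ ≤ φ r) →
      (∀ r, 0 < r → 0 ≤ φ r) →
      (∀ R, 0 < R → R < R₀ → φ (R * (1 / 4)) ≤ κ * φ R) →
      ∀ ρ r, 0 < ρ → ρ < r → r ≤ R₀ → φ ρ ≤ κ⁻¹ * 2 ^ γ * (ρ / r) ^ γ * φ r := by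
  have hl4 : Real.log (1 / 4) < 0 := Real.log_neg (by norm_num) (by norm_num)
  -- The exponent solves `(1/4) ^ γ = κ`.
  refine ⟨Real.log κ / Real.log (1 / 4), div_pos_of_neg_of_neg (Real.log_neg hκ0 hκ1) hl4, ?_⟩
  set γ := Real.log κ / Real.log (1 / 4) with hγ
  have hγ0 : 0 < γ := div_pos_of_neg_of_neg (Real.log_neg hκ0 hκ1) hl4
  have hκγ : (1 / 4 : ℝ) ^ γ = κ := by
    rw [Real.rpow_def_of_pos (by norm_num), hγ, mul_div_cancel₀ _ hl4.ne, Real.exp_log hκ0]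
  intro R₀ φ hmono hnonneg hdecay ρ r hρ hρr hr
  have hr0 : 0 < r := hρ.trans hρr
  have hφ := hnonneg r hr0
  -- The iteration starts at `r / 2`, since the one-step decay needs radii strictly below `R₀` while
  -- `r = R₀` is allowed. This costs the factor `2 ^ γ`; the factor `κ⁻¹` covers radii between
  -- consecutive steps.
  have h2 : (2 : ℝ) ^ γ * (ρ / r) ^ γ = (ρ / (r / 2)) ^ γ := by
    rw [← Real.mul_rpow (by norm_num) (by positivity)]
    congr 1
    field_simp
  rw [mul_assoc κ⁻¹, h2]
  have hκinv : 1 ≤ κ⁻¹ := (one_le_inv₀ hκ0).2 hκ1.le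
  rcases le_or_gt (r / 2) ρ with h | h
  · have h1 : 1 ≤ (ρ / (r / 2)) ^ γ :=
      Real.one_le_rpow ((one_le_div (by positivity)).2 h) hγ0.le
    refine (hmono ρ r hρ hρr.le).trans (le_mul_of_one_le_left hφ ?_)
    exact one_le_mul_of_one_le_of_one_le hκinv h1
  · have hiter : ∀ k : ℕ, φ (r / 2 * (1 / 4) ^ k) ≤ κ ^ k * φ (r / 2) := by
      intro k
      induction k with
      | zero => simp
      | succ k ih =>
        have hp : (0 : ℝ) < (1 / 4) ^ k := by positivity
        have hp1 : (1 / 4 : ℝ) ^ k ≤ 1 := pow_le_one₀ (by norm_num) (by norm_num)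
        rw [pow_succ, ← mul_assoc, pow_succ κ, mul_comm (κ ^ k), mul_assoc κ]
        refine (hdecay _ (by positivity) ?_).trans (mul_le_mul_of_nonneg_left ih hκ0.le)
        calc r / 2 * (1 / 4) ^ k ≤ r / 2 := mul_le_of_le_one_right (by positivity) hp1
          _ < R₀ := by linarith
    obtain ⟨k, hk1, hk2⟩ := exists_nat_pow_near_of_lt_one (x := ρ / (r / 2)) (y := 1 / 4)
      (by positivity) ((div_le_one (by positivity)).2 h.le) (by norm_num) (by norm_num)
    have hρk : ρ ≤ r / 2 * (1 / 4) ^ k := by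
      rw [div_le_iff₀ (by positivity)] at hk2
      linarith
    have hpow : κ ^ (k + 1) ≤ (ρ / (r / 2)) ^ γ := by
      rw [← hκγ, ← Real.rpow_natCast, ← Real.rpow_mul (by norm_num), mul_comm γ,
        Real.rpow_mul (by norm_num), Real.rpow_natCast]
      exact Real.rpow_le_rpow (by positivity) hk1.le hγ0.le
    calc φ ρ ≤ κ ^ k * φ (r / 2) := (hmono _ _ hρ hρk).trans (hiter k)
      _ = κ⁻¹ * κ ^ (k + 1) * φ (r / 2) := by
          rw [pow_succ]
          field_simp
      _ ≤ κ⁻¹ * (ρ / (r / 2)) ^ γ * φ r := by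
          have := hnonneg (r / 2) (by positivity)
          gcongr
          exact hmono _ _ (by positivity) (by linarith)

end DivEq

theorem corollary2p3 (n : ℕ) (hn : 2 ≤ n) (ν : ℝ) (hν : 0 < ν) (q : ℝ)
    (hq : (n : ℝ) / 2 < q) (hqn : q ≤ (n : ℝ)) (S : ℝ≥0) :
    ∃ N₂ γ : ℝ, 0 < N₂ ∧ 0 < γ ∧
      ∀ (R₀ : ℝ), 0 < R₀ →
      ∀ (a : DivEq.E n → Matrix (Fin n) (Fin n) ℝ) (b : DivEq.E n → DivEq.E n),
        DivEq.UniformlyElliptic ν a (Metric.ball 0 R₀) →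
        MemLp b (ENNReal.ofReal q) (volume.restrict (Metric.ball 0 R₀)) →
        DivEq.DivNonpos b (Metric.ball 0 R₀) →
        (⨆ R ∈ Ioo (0 : ℝ) R₀, DivEq.scaledNorm q b R) ≤ (S : ℝ≥0∞) →
        ∀ u : DivEq.E n → ℝ, DivEq.IsLipschitzSolution a b (Metric.ball 0 R₀) u →
          ∀ ρ r : ℝ, 0 < ρ → ρ < r → r ≤ R₀ →
            DivEq.osc (Metric.ball 0 ρ) u ≤
              N₂ * (ρ / r) ^ γ * DivEq.osc (Metric.ball 0 r) u := by
  obtain ⟨κ, hκ0, hκ1, hstep⟩ := DivEq.exists_osc_step hn hν hq S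
  obtain ⟨γ, hγ, hdecay⟩ := DivEq.le_rpow_of_geometric_decay hκ0 hκ1
  refine ⟨κ⁻¹ * 2 ^ γ, γ, by positivity, hγ, ?_⟩
  intro R₀ _ a b ha hb hdiv hS u hu ρ r hρ hρr hr
  obtain ⟨K, hK⟩ := hu.1.lipschitz
  -- A bounded global Lipschitz extension changes neither the weak form nor the oscillations, as the
  -- ball is open and contains all smaller balls; `K` and `M` do not affect the decay constants.
  obtain ⟨U, M, hU, hM, huU⟩ := DivEq.exists_bounded_extension hK
  have hweak : ∀ η, DivEq.IsTest (Metric.ball 0 R₀) η →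
      DivEq.weakForm a b (Metric.ball 0 R₀) U η = 0 := fun η hη => by
    rw [← DivEq.weakForm_congr Metric.isOpen_ball huU]
    exact le_antisymm (hu.1.weak η hη) (hu.2.weak η hη)
  rw [DivEq.osc_congr huU (Metric.ball_subset_ball (hρr.le.trans hr)),
    DivEq.osc_congr huU (Metric.ball_subset_ball hr)]
  exact hdecay R₀ (fun r => DivEq.osc (Metric.ball 0 r) U)
    (fun ρ r hρ h => DivEq.osc_mono (Metric.nonempty_ball.2 hρ) (Metric.ball_subset_ball h) hM)
    (fun r hr => DivEq.osc_nonneg (Metric.nonempty_ball.2 hr) hM)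
    (hstep R₀ a b ha hb hdiv hS U K M hU hM hweak) ρ r hρ hρr hr
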